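/- All graphs are finite and simple. For a graph $G$ and an integer $k\ge 0$, the $k$-coloring graph $\mathcal C_k(G)$ has as vertices the proper colorings of $G$ with palette $\{1,\dots,k\}$; two colorings are adjacent if they differ on exactly one vertex of $G$. **Theorem.** Let $G$ be a graph with at least one vertex, let $k>\chi(G)$, and let $\mathcal C$ be a graph with $\mathcal C\cong\mathcal C_k(G)$. Then for every graph $G'$ and every integer $k'\ge 0$ with $\mathcal C\cong\mathcal C_{k'}(G')$ we have $G\cong G'$ and $k=k'$. In particular: (a) if $k'>\chi(G')$ and $\mathcal C_k(G)\cong\mathcal C_{k'}(G')$, then $G\cong G'$ and $k=k'$; (b) there is no graph $G'$ with $\mathcal C_k(G)\cong\mathcal C_{\chi(G')}(G')$. Moreover, the following procedure, applied to $\mathcal C$, does not abort and returns a nonempty set $A$, a graph isomorphic to $G$, and the number $k$, for every choice of $\alpha$ in step 5: 1. Let $A$ be the set of vertices $\alpha$ of $\mathcal C$ whose neighborhood induces a disjoint union of cliques. Keep in $A$ only the vertices for which the number of these cliques is largest. 2. For $\alpha\in A$ and two different cliques $K,L$ in its neighborhood, call the pair $\{K,L\}$ deficient if there are strictly fewer than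 $|K|\cdot|L|$ squares spanning them, i.e. triples $(x,y,z)$ with $x\in K$, $y\in L$, $z\neq\alpha$ and $z$ adjacent to both $x$ and $y$. Keep in $A$ only the vertices with the largest number of deficient pairs. 3. For $\alpha\in A$ let $M_\alpha$ be the graph (adjacency matrix) on the cliques in the neighborhood of $\alpha$ whose edges are the deficient pairs, with connected components $H_1,\dots,H_d$. Let $f_\ell(\alpha)$ be the number of ways to choose one vertex from each clique in $H_\ell$ such that no square spans the vertices chosen from two cliques adjacent in $M_\alpha$. 4. Keep in $A$ only the vertices for which $f(\alpha)=\sum_\ell f_\ell(\alpha)$ is largest. 5. Choose any $\alpha\in A$. Compute $k=\frac1d\bigl(f(\alpha)+\sum_{\ell=1}^d\chi(H_\ell)\bigr)$. If this is not defined, or not an integer, or if $\mathcal C\not\cong\mathcal C_k(M_\alpha)$, abort; otherwise return $A$, $M_\alpha$ and $k$. -/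

import Mathlib

universe u v w

namespace SimpleGraph

/-- The `k`-coloring graph of `G`: its vertices are the proper `k`-colorings of `G`, and two of
them are adjacent when they differ on exactly one vertex of `G`. -/
def coloringGraph {V : Type u} (G : SimpleGraph V) (k : ℕ) :
    SimpleGraph (G.Coloring (Fin k)) where
  Adj a b := ∃! v, a v ≠ b v
  symm := ⟨fun _ _ h => by simpa only [ne_comm] using h⟩
  loopless := ⟨fun _ h => by obtain ⟨v, hv, -⟩ := h; exact hv rfl⟩

end SimpleGraph

/-! The reconstruction procedure. All definitions below are executable; they only use the
adjacency relation of the finite input graph `C`. -/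

namespace Reconstruction

section Decide

/-- Colorability of a finite graph is decided by trying all maps to the palette. -/
instance decidableColorable {V : Type u} [Fintype V] [DecidableEq V] (G : SimpleGraph V)
    [DecidableRel G.Adj] (n : ℕ) : Decidable (G.Colorable n) :=
  decidable_of_iff (∃ c : V → Fin n, ∀ x y, G.Adj x y → c x ≠ c y)
    ⟨fun ⟨c, hc⟩ => ⟨SimpleGraph.Coloring.mk c fun {x y} h => hc x y h⟩,
      fun ⟨c⟩ => ⟨c, fun _ _ h => c.valid h⟩⟩

/-- The chromatic number of a finite graph, found by search. -/
def chi {V : Type u} [Fintype V] [DecidableEq V] (G : SimpleGraph V) [DecidableRel G.Adj] : ℕ :=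
  Nat.find (p := fun n => G.Colorable n) ⟨Fintype.card V, G.colorable_of_fintype⟩

theorem coe_chi {V : Type u} [Fintype V] [DecidableEq V] (G : SimpleGraph V)
    [DecidableRel G.Adj] : (chi G : ℕ∞) = G.chromaticNumber := by
  apply le_antisymm
  · rw [SimpleGraph.le_chromaticNumber_iff_colorable]
    exact fun m hm => Nat.find_min' _ hm
  · exact SimpleGraph.Colorable.chromaticNumber_le (Nat.find_spec (p := fun n => G.Colorable n) _)

/-- An executable enumeration of the proper `k`-colorings. -/
@[reducible]
def fintypeColoring {V : Type u} [Fintype V] [DecidableEq V] (G : SimpleGraph V)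
    [DecidableRel G.Adj] (k : ℕ) : Fintype (G.Coloring (Fin k)) :=
  Fintype.ofEquiv {c : V → Fin k // ∀ x y, G.Adj x y → c x ≠ c y}
    { toFun := fun c => SimpleGraph.Coloring.mk c.1 fun {x y} h => c.2 x y h
      invFun := fun c => ⟨c, fun _ _ h => c.valid h⟩
      left_inv := fun _ => rfl
      right_inv := fun _ => rfl }

instance decidableEqColoring {V : Type u} [Fintype V] (G : SimpleGraph V) (k : ℕ) :
    DecidableEq (G.Coloring (Fin k)) := fun a b =>
  decidable_of_iff (∀ x, a x = b x) ⟨fun h => RelHom.ext h, fun h x => by rw [h]⟩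

/-- Isomorphism of a finite graph with a coloring graph is decided by trying all bijections. -/
instance decidableIsoColoringGraph {W : Type u} [Fintype W] [DecidableEq W] (C : SimpleGraph W)
    [DecidableRel C.Adj] {V : Type v} [Fintype V] [DecidableEq V] (G : SimpleGraph V)
    [DecidableRel G.Adj] (k : ℕ) : Decidable (Nonempty (C ≃g G.coloringGraph k)) :=
  letI := fintypeColoring G k
  haveI : DecidableRel (G.coloringGraph k).Adj := fun a b =>
    inferInstanceAs (Decidable (∃ x, a x ≠ b x ∧ ∀ y, a y ≠ b y → y = x))
  decidable_of_iff (∃ e : W ≃ G.Coloring (Fin k),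
      ∀ x y, (G.coloringGraph k).Adj (e x) (e y) ↔ C.Adj x y)
    ⟨fun ⟨e, he⟩ => ⟨⟨e, fun {x y} => he x y⟩⟩, fun ⟨e⟩ => ⟨e.toEquiv, fun _ _ => e.map_adj_iff⟩⟩

end Decide

section Procedure

variable {W : Type u} [Fintype W] [DecidableEq W] (C : SimpleGraph W) [DecidableRel C.Adj]

/-- The neighborhood of `a` induces a disjoint union of cliques: being equal or adjacent is a
transitive relation on it. -/
def CliqueNeighborhood (a : W) : Prop :=
  ∀ x y z, C.Adj a x → C.Adj a y → C.Adj a z → C.Adj x y → C.Adj y z → x ≠ z → C.Adj x z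

instance (a : W) : Decidable (CliqueNeighborhood C a) :=
  inferInstanceAs (Decidable
    (∀ x y z, C.Adj a x → C.Adj a y → C.Adj a z → C.Adj x y → C.Adj y z → x ≠ z → C.Adj x z))

/-- The cliques that make up the neighborhood of `a` (if it is a disjoint union of cliques): the
clique of a neighbor `x` consists of `x` and its neighbors among the neighbors of `a`. -/
def cliques (a : W) : Finset (Finset W) :=
  (C.neighborFinset a).image fun x => {y ∈ C.neighborFinset a | y = x ∨ C.Adj x y}

/-- The cliques in the neighborhood of `a`, as a type; they serve as labels `v₁, …, vᵣ`. -/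
abbrev Clique (a : W) : Type u := {K : Finset W // K ∈ cliques C a}

/-- A vertex `z ≠ a` completes `a, x, y` to a square `a x z y`. -/
def ClosesSquare (a x y z : W) : Prop := z ≠ a ∧ C.Adj x z ∧ C.Adj y z

instance (a x y z : W) : Decidable (ClosesSquare C a x y z) :=
  inferInstanceAs (Decidable (z ≠ a ∧ C.Adj x z ∧ C.Adj y z))

/-- The squares at `a` that span the cliques `K` and `L` in the neighborhood of `a`. -/
def squares (a : W) (K L : Finset W) : Finset (W × W × W) :=
  {s ∈ K ×ˢ L ×ˢ Finset.univ | ClosesSquare C a s.1 s.2.1 s.2.2}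

/-- The matrix of `a`: the entry at two different cliques is `1` exactly if strictly fewer squares
than the product of their sizes span them. -/
def matrix (a : W) : Matrix (Clique C a) (Clique C a) ℕ := fun K L =>
  if K ≠ L ∧ (squares C a K.1 L.1).card < K.1.card * L.1.card then 1 else 0

/-- The graph with a given adjacency matrix. -/
def toGraph {ι : Type u} (M : Matrix ι ι ℕ) : SimpleGraph ι :=
  SimpleGraph.fromRel fun i j => M i j = 1

instance {ι : Type u} [DecidableEq ι] (M : Matrix ι ι ℕ) : DecidableRel (toGraph M).Adj := fun i j =>
  decidable_of_iff (i ≠ j ∧ (M i j = 1 ∨ M j i = 1)) (by simp [toGraph])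

/-- The connected components of the graph given by the matrix of `a`. -/
abbrev Component (a : W) : Type u := (toGraph (matrix C a)).ConnectedComponent

/-- The cliques that belong to the component `H`. -/
abbrev Part (a : W) (H : Component C a) : Type u := {K : Clique C a // K ∈ H.supp}

/-- A choice `s` of one vertex from every clique that belongs to the component `H`, such that no
square spans the vertices chosen from two cliques where the matrix has entry `1`. -/
def IsSelection (a : W) (H : Component C a) (s : Part C a H → W) : Prop :=
  (∀ K, s K ∈ K.1.1) ∧
    ∀ K L, matrix C a K.1 L.1 = 1 → ¬ ∃ z, ClosesSquare C a (s K) (s L) z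

instance (a : W) (H : Component C a) (s : Part C a H → W) : Decidable (IsSelection C a H s) :=
  inferInstanceAs (Decidable ((∀ K, s K ∈ K.1.1) ∧
    ∀ K L, matrix C a K.1 L.1 = 1 → ¬ ∃ z, ClosesSquare C a (s K) (s L) z))

/-- The number of such choices. -/
def selections (a : W) (H : Component C a) : ℕ :=
  (Finset.univ.filter (IsSelection C a H)).card

/-- The sum of `selections` over all components. -/
def totalSelections (a : W) : ℕ := ∑ H : Component C a, selections C a H

/-- The chromatic number of a component. -/
def componentChi (a : W) (H : Component C a) : ℕ :=
  chi ((toGraph (matrix C a)).induce H.supp)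

/-- First candidates: the vertices whose neighborhood is a disjoint union of cliques. -/
def candidates₁ : Finset W := {a | CliqueNeighborhood C a}

/-- Second candidates: among the first ones, those with the largest number of cliques. -/
def candidates₂ : Finset W :=
  {a ∈ candidates₁ C | ∀ b ∈ candidates₁ C, (cliques C b).card ≤ (cliques C a).card}

/-- The number of (unordered) pairs of cliques at `a` with too few squares. -/
def deficientPairs (a : W) : ℕ := (toGraph (matrix C a)).edgeFinset.card

/-- Third candidates: among the second ones, those with the most deficient pairs. -/
def candidates₃ : Finset W :=
  {a ∈ candidates₂ C | ∀ b ∈ candidates₂ C, deficientPairs C b ≤ deficientPairs C a}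

/-- The final candidates: among the third ones, those with the largest total number of
selections. -/
def finalCandidates : Finset W :=
  {a ∈ candidates₃ C | ∀ b ∈ candidates₃ C, totalSelections C b ≤ totalSelections C a}

/-- The numerator in the formula for the number of colors. (At a final candidate `a`,
`totalSelections C a` is the maximum over all third candidates.) -/
def colorNumerator (a : W) : ℕ := totalSelections C a + ∑ H : Component C a, componentChi C a H

/-- The number of colors: `1 / d` times the numerator, where `d` is the number of components. -/
def colors (a : W) : ℕ := colorNumerator C a / Fintype.card (Component C a)

/-- The reconstruction procedure. Its input is a finite graph `C`; the argument `a` is the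
candidate from which the output is read off, an arbitrary choice among the final candidates.
It returns the set of final candidates, an adjacency matrix, and a number of colors `k`, and it
aborts (`none`) if the formula for `k` does not yield an integer or if `C` is not isomorphic to
the `k`-coloring graph of the graph with this adjacency matrix. -/
def reconstruct (a : W) : Option (Finset W × Matrix (Clique C a) (Clique C a) ℕ × ℕ) :=
  if a ∈ finalCandidates C ∧ 0 < Fintype.card (Component C a) ∧
      Fintype.card (Component C a) ∣ colorNumerator C a ∧
      Nonempty (C ≃g (toGraph (matrix C a)).coloringGraph (colors C a)) then
    some (finalCandidates C, matrix C a, colors C a)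
  else none

end Procedure

end Reconstruction

/-!
Let `e` be an isomorphism from a graph `C` to `G.coloringGraph k`, where `k > χ(G)`.

**The procedure.** The neighbors of a coloring `α` are the recolorings of single vertices, and two
of them are adjacent precisely if they recolor the same vertex. So the cliques in the neighborhood
correspond to the vertices of `G` that can be recolored (`Reconstruction.cliqueEquiv`), and their
number is largest if no vertex is frozen, that is, if every vertex can be recolored. Recolorings
of two vertices fail to span a square precisely if the vertices are adjacent and get the same new
color; so the deficient pairs are the edges of `G` whose ends can be recolored with the same
color, and their number is largest if these are all edges, as happens when `α` misses a color. A
selection on a component `H` recolors all of `H` with one color, so there is one for every color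
that `α` misses on `H` (`Reconstruction.selections_eq`). Their total number is largest if `α` uses
only `χ(H)` colors on every component `H`; then the missing colors and the chromatic number add up
to `k` on every component, which gives the formula for `k` (`Reconstruction.reconstruct_spec`).

**Uniqueness.** If `C` is also the `k'`-coloring graph of `G'` and `k' > χ(G')`, then the
procedure returns both `G` and `G'`. It remains to show that `k' > χ(G')`. Fix a coloring `α` of
`G` that misses a color, and let `α'` be the corresponding coloring of `G'`. Recolorings of a
vertex `v` of `G` correspond to recolorings of a vertex of `G'`, the label of `v` at `α`. If a
component `H` misses the color `c`, then recoloring a color class of `H` with `c`, a flip, amounts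
to recoloring the labels of that class with a fixed color (`SimpleGraph.exists_isFlip`). The main
point is that a flip preserves the set of labels of `H`, whether or not the labels of individual
vertices change (`SimpleGraph.exists_hasLabel_swapOn`). With flips one finds that on `H` the
colors of `G` correspond injectively to colors of `G'` (`SimpleGraph.ColorImage`) that do not
occur at the neighbors of the labels of `H` outside this set, and that components with adjacent
labels use disjoint sets of colors. Hence every coloring of `G` can be copied to the labels, while
all vertices that are frozen in `α'` keep their color. If there were frozen vertices, then the
colorings of `G'` obtained in this way would not be all of them, as one sees by permuting the
colors; but there are as many of them as colorings of `G`. So no vertex is frozen in `α'`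
(`SimpleGraph.exists_hasLabel`), and then a color class can be recolored away, so that `k' >
χ(G')`.
-/

/-! ### Recoloring a vertex, and transfer of recolorings to `G'` -/

namespace SimpleGraph

section Moves

variable {V : Type*} {G : SimpleGraph V} {k : ℕ}

/-- The colorings `α` and `β` differ at `v` and nowhere else. -/
def DifferAt (α β : G.Coloring (Fin k)) (v : V) : Prop :=
  α v ≠ β v ∧ ∀ w, w ≠ v → α w = β w

/-- The vertex `v` can be recolored with the new color `c`. -/
def Available (α : G.Coloring (Fin k)) (v : V) (c : Fin k) : Prop :=
  c ≠ α v ∧ ∀ w, G.Adj v w → α w ≠ c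

variable {α β γ δ : G.Coloring (Fin k)} {v w : V} {c d : Fin k}

theorem DifferAt.symm (h : DifferAt α β v) : DifferAt β α v :=
  ⟨h.1.symm, fun w hw => (h.2 w hw).symm⟩

theorem coloringGraph_adj : (G.coloringGraph k).Adj α β ↔ ∃ v, DifferAt α β v := by
  constructor
  · rintro ⟨v, hv, h⟩
    exact ⟨v, hv, fun w hw => by_contra fun h' => hw (h w h')⟩
  · rintro ⟨v, hv, h⟩
    exact ⟨v, hv, fun w hw => by_contra fun h' => hw (h w h')⟩

theorem DifferAt.adj (h : DifferAt α β v) : (G.coloringGraph k).Adj α β :=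
  coloringGraph_adj.2 ⟨v, h⟩

theorem DifferAt.eq_vertex (h : DifferAt α β v) (h' : DifferAt α β w) : v = w :=
  by_contra fun hne => h.1 (h'.2 v hne)

theorem DifferAt.not_adj (h : DifferAt α β v) (h' : DifferAt α γ w) (hne : v ≠ w) :
    ¬ (G.coloringGraph k).Adj β γ := by
  rw [coloringGraph_adj]
  rintro ⟨x, hx⟩
  have h1 : v = x := by_contra fun hvx => h.1 ((h'.2 v hne).trans (hx.2 v hvx).symm)
  have h2 : w = x := by_contra fun hwx => h'.1 ((h.2 w hne.symm).trans (hx.2 w hwx))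
  exact hne (h1.trans h2.symm)

theorem DifferAt.eq_or_differAt (h : DifferAt α β v) (h' : DifferAt α γ v) :
    β = γ ∨ DifferAt β γ v := by
  by_cases hc : β v = γ v
  · left
    ext1 x
    by_cases hx : x = v
    · rw [hx, hc]
    · rw [← h.2 x hx, h'.2 x hx]
  · exact Or.inr ⟨hc, fun x hx => by rw [← h.2 x hx, h'.2 x hx]⟩

theorem DifferAt.eq_of_apply_eq (h : DifferAt α β v) (h' : DifferAt α γ v) (hc : β v = γ v) :
    β = γ :=
  (h.eq_or_differAt h').resolve_right fun h'' => h''.1 hc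

theorem DifferAt.available (h : DifferAt α β v) : Available α v (β v) :=
  ⟨h.1.symm, fun w hw => by
    rw [h.2 w hw.ne']
    exact (β.valid hw).symm⟩

theorem Available.exists_differAt (h : Available α v c) : ∃ β, DifferAt α β v ∧ β v = c := by
  classical
  refine ⟨Coloring.mk (fun x => if x = v then c else α x) ?_, ⟨?_, ?_⟩, ?_⟩
  · intro x y hxy
    split_ifs with h1 h2 h2
    · exact absurd (h1.trans h2.symm) hxy.ne
    · exact (h.2 y (h1 ▸ hxy)).symm
    · exact h.2 x (h2 ▸ hxy.symm)
    · exact α.valid hxy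
  · change α v ≠ if v = v then c else α v
    rw [if_pos rfl]
    exact h.1.symm
  · intro x hx
    change α x = if x = v then c else α x
    rw [if_neg hx]
  · change (if v = v then c else α v) = c
    rw [if_pos rfl]

/-- Recolorings of two different vertices can be combined unless the vertices are adjacent and
receive the same color. -/
theorem DifferAt.exists_square (h : DifferAt α β v) (h' : DifferAt α γ w) (hne : v ≠ w)
    (hvw : ¬ (G.Adj v w ∧ β v = γ w)) : ∃ δ, δ ≠ α ∧ DifferAt β δ w ∧ DifferAt γ δ v := by
  have hav : Available β w (γ w) := by
    refine ⟨?_, fun x hx => ?_⟩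
    · rw [← h.2 w hne.symm]
      exact h'.1.symm
    · by_cases hxv : x = v
      · subst hxv
        exact fun h'' => hvw ⟨hx.symm, h''⟩
      · rw [← h.2 x hxv]
        exact h'.available.2 x hx
  obtain ⟨δ, hδ, hδw⟩ := hav.exists_differAt
  refine ⟨δ, ?_, hδ, ?_, ?_⟩
  · rintro rfl
    exact h'.1 hδw
  · rw [← h'.2 v hne, ← hδ.2 v hne]
    exact h.1
  · intro x hx
    by_cases hxw : x = w
    · rw [hxw, hδw]
    · rw [← h'.2 x hxw, ← hδ.2 x hxw, h.2 x hx]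

/-- A square through `α` is determined by the two recolorings of `α` on it. -/
theorem DifferAt.of_square (h : DifferAt α β v) (h' : DifferAt α γ w) (hne : v ≠ w) (hδ : δ ≠ α)
    (hβ : (G.coloringGraph k).Adj β δ) (hγ : (G.coloringGraph k).Adj γ δ) :
    DifferAt β δ w ∧ DifferAt γ δ v := by
  obtain ⟨x, hx⟩ := coloringGraph_adj.1 hβ
  obtain ⟨y, hy⟩ := coloringGraph_adj.1 hγ
  -- `β` and `γ` differ exactly at `v` and `w`, so `{x, y} = {v, w}`
  have hv : v = x ∨ v = y := by
    by_contra! hh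
    exact h.1 (((h'.2 v hne).trans (hy.2 v hh.2)).trans (hx.2 v hh.1).symm)
  have hw : w = x ∨ w = y := by
    by_contra! hh
    exact h'.1 (((h.2 w hne.symm).trans (hx.2 w hh.1)).trans (hy.2 w hh.2).symm)
  rcases hw with rfl | rfl
  · rcases hv with rfl | rfl
    · exact absurd rfl hne
    · exact ⟨hx, hy⟩
  · rcases hv with rfl | rfl
    · refine absurd ?_ hδ
      ext1 z
      by_cases hz : z = v
      · subst hz
        rw [← hy.2 z hne, ← h'.2 z hne]
      · rw [← hx.2 z hz, ← h.2 z hz]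
    · exact absurd rfl hne

theorem DifferAt.square_iff (h : DifferAt α β v) (h' : DifferAt α γ w) (hne : v ≠ w) :
    (∃ δ, δ ≠ α ∧ (G.coloringGraph k).Adj β δ ∧ (G.coloringGraph k).Adj γ δ) ↔
      ¬ (G.Adj v w ∧ β v = γ w) := by
  constructor
  · rintro ⟨δ, hδ, hβ, hγ⟩ ⟨hvw, hc⟩
    obtain ⟨h1, h2⟩ := h.of_square h' hne hδ hβ hγ
    exact δ.valid hvw (by rw [← h1.2 v hne, ← h2.2 w hne.symm, hc])
  · intro hvw
    obtain ⟨δ, hδ, h1, h2⟩ := h.exists_square h' hne hvw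
    exact ⟨δ, hδ, h1.adj, h2.adj⟩

end Moves

section Transfer

variable {V : Type*} {V' : Type*} {G : SimpleGraph V} {G' : SimpleGraph V'} {k k' : ℕ}

/-- Under the isomorphism `e`, recoloring `v` with `c` in the coloring `α` corresponds to
recoloring `x` with `c'` in the coloring `e α`. -/
def Transfers (e : G.coloringGraph k ≃g G'.coloringGraph k') (α : G.Coloring (Fin k)) (v : V)
    (c : Fin k) (x : V') (c' : Fin k') : Prop :=
  ∃ β, DifferAt α β v ∧ β v = c ∧ DifferAt (e α) (e β) x ∧ e β x = c'

/-- Under the isomorphism `e`, recolorings of `v` in the coloring `α` correspond to recolorings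
of `x` in the coloring `e α`. -/
def HasLabel (e : G.coloringGraph k ≃g G'.coloringGraph k') (α : G.Coloring (Fin k)) (v : V)
    (x : V') : Prop :=
  ∃ c c', Transfers e α v c x c'

variable {e : G.coloringGraph k ≃g G'.coloringGraph k'} {α β : G.Coloring (Fin k)} {v w : V}
  {c d : Fin k} {x y : V'} {c' d' : Fin k'}

theorem Transfers.hasLabel (h : Transfers e α v c x c') : HasLabel e α v x := ⟨c, c', h⟩

theorem Available.exists_transfers (e : G.coloringGraph k ≃g G'.coloringGraph k')
    (h : Available α v c) : ∃ x c', Transfers e α v c x c' := by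
  obtain ⟨β, hβ, hc⟩ := h.exists_differAt
  obtain ⟨x, hx⟩ := coloringGraph_adj.1 (e.map_adj_iff.2 hβ.adj)
  exact ⟨x, _, β, hβ, hc, hx, rfl⟩

theorem Transfers.symm (h : Transfers e α v c x c') : Transfers e.symm (e α) x c' v c := by
  obtain ⟨β, h1, h2, h3, h4⟩ := h
  exact ⟨e β, h3, h4, by simpa using h1, by simpa using h2⟩

theorem HasLabel.symm (h : HasLabel e α v x) : HasLabel e.symm (e α) x v := by
  obtain ⟨c, c', h⟩ := h
  exact ⟨c', c, h.symm⟩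

theorem HasLabel.unique (h : HasLabel e α v x) (h' : HasLabel e α v y) : x = y := by
  obtain ⟨c, c', β, h1, -, h3, -⟩ := h
  obtain ⟨d, d', γ, g1, -, g3, -⟩ := h'
  by_contra hne
  rcases h1.eq_or_differAt g1 with rfl | h
  · exact hne (h3.eq_vertex g3)
  · exact h3.not_adj g3 hne (e.map_adj_iff.2 h.adj)

theorem HasLabel.injective (h : HasLabel e α v x) (h' : HasLabel e α w x) : v = w :=
  h.symm.unique h'.symm

theorem Transfers.unique (h : Transfers e α v c x c') (h' : Transfers e α v c y d') :
    c' = d' := by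
  have hxy := h.hasLabel.unique h'.hasLabel
  obtain ⟨β, h1, h2, h3, h4⟩ := h
  obtain ⟨γ, g1, g2, g3, g4⟩ := h'
  obtain rfl := h1.eq_of_apply_eq g1 (h2.trans g2.symm)
  rw [← h4, ← g4, hxy]

theorem Transfers.injective (h : Transfers e α v c x c') (h' : Transfers e α w d x c') : c = d :=
  h.symm.unique h'.symm

theorem Transfers.available (h : Transfers e α v c x c') : Available (e α) x c' := by
  obtain ⟨β, -, -, h3, h4⟩ := h
  exact h4 ▸ h3.available

theorem Transfers.square_iff (h : Transfers e α v c x c') (h' : Transfers e α w d y d')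
    (hne : v ≠ w) : (G.Adj v w ∧ c = d) ↔ (G'.Adj x y ∧ c' = d') := by
  have hxy : x ≠ y := fun hh => hne (h.hasLabel.injective (hh ▸ h'.hasLabel))
  obtain ⟨β, h1, h2, h3, h4⟩ := h
  obtain ⟨γ, g1, g2, g3, g4⟩ := h'
  rw [← not_iff_not, ← h2, ← g2, ← h4, ← g4, ← h1.square_iff g1 hne, ← h3.square_iff g3 hxy]
  constructor
  · rintro ⟨δ, hδ, hb, hc⟩
    exact ⟨e δ, fun hh => hδ (e.injective hh), e.map_adj_iff.2 hb, e.map_adj_iff.2 hc⟩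
  · rintro ⟨δ, hδ, hb, hc⟩
    obtain ⟨δ, rfl⟩ := e.surjective δ
    exact ⟨δ, fun hh => hδ (by rw [hh]), e.map_adj_iff.1 hb, e.map_adj_iff.1 hc⟩

/-- Opposite sides of a square transfer to opposite sides of a square. -/
theorem Transfers.move (h : Transfers e α v c x c') (h' : Transfers e α w d y d')
    (hne : v ≠ w) (hvw : ¬ (G.Adj v w ∧ c = d)) (hβ : DifferAt α β v) (hc : β v = c) :
    Transfers e β w d y d' := by
  have hxy : x ≠ y := fun hh => hne (h.hasLabel.injective (hh ▸ h'.hasLabel))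
  obtain ⟨β', h1, h2, h3, h4⟩ := h
  obtain rfl := hβ.eq_of_apply_eq h1 (hc.trans h2.symm)
  obtain ⟨γ, g1, g2, g3, g4⟩ := h'
  rw [← h2, ← g2] at hvw
  obtain ⟨δ, hδ, hb, hg⟩ := h1.exists_square g1 hne hvw
  obtain ⟨hb', hg'⟩ := h3.of_square g3 hxy (δ := e δ) (fun hh => hδ (e.injective hh))
    (e.map_adj_iff.2 hb.adj) (e.map_adj_iff.2 hg.adj)
  exact ⟨δ, hb, by rw [← g2, hg.2 w hne.symm], hb', by rw [← g4, hg'.2 y hxy.symm]⟩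

theorem Transfers.differAt (h : Transfers e α v c x c') (hβ : DifferAt α β v) (hc : β v = c) :
    DifferAt (e α) (e β) x ∧ e β x = c' := by
  obtain ⟨β', h1, h2, h3, h4⟩ := h
  obtain rfl := hβ.eq_of_apply_eq h1 (hc.trans h2.symm)
  exact ⟨h3, h4⟩

theorem Transfers.back (h : Transfers e α v c x c') (hβ : DifferAt α β v) (hc : β v = c) :
    Transfers e β v (α v) x (e α x) :=
  ⟨α, hβ.symm, rfl, (h.differAt hβ hc).1.symm, rfl⟩

end Transfer

end SimpleGraph

/-! ### Flips of color classes -/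

namespace SimpleGraph

section Swap

variable {V : Type*} {V' : Type*} {G : SimpleGraph V} {G' : SimpleGraph V'} {k k' : ℕ}

open Classical in
/-- The coloring obtained from `α` by exchanging the colors `a` and `c` on the component `H`. -/
noncomputable def swapOn (H : G.ConnectedComponent) (a c : Fin k) (α : G.Coloring (Fin k)) :
    G.Coloring (Fin k) :=
  Coloring.mk (fun v => if v ∈ H.supp then Equiv.swap a c (α v) else α v) fun {v w} hvw => by
    have hH := H.mem_supp_congr_adj hvw
    by_cases hv : v ∈ H.supp
    · rw [if_pos hv, if_pos (hH.1 hv)]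
      exact fun h => α.valid hvw ((Equiv.swap a c).injective h)
    · rw [if_neg hv, if_neg (fun h => hv (hH.2 h))]
      exact α.valid hvw

variable {H : G.ConnectedComponent} {a c : Fin k} {α β : G.Coloring (Fin k)} {v : V}

theorem swapOn_of_mem (hv : v ∈ H.supp) : swapOn H a c α v = Equiv.swap a c (α v) := if_pos hv

theorem swapOn_of_notMem (hv : v ∉ H.supp) : swapOn H a c α v = α v := if_neg hv

theorem available_of_missing (hc : ∀ v ∈ H.supp, α v ≠ c) (hv : v ∈ H.supp) :
    Available α v c :=
  ⟨(hc v hv).symm, fun w hw => hc w ((H.mem_supp_congr_adj hw).1 hv)⟩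

variable {e : G.coloringGraph k ≃g G'.coloringGraph k'}

/-- Recoloring adjacent vertices with the same color does not extend to a square, hence the
recolorings of a component with a color it misses all use one and the same color in `G'`. -/
theorem exists_transfers_of_missing (e : G.coloringGraph k ≃g G'.coloringGraph k')
    (hc : ∀ v ∈ H.supp, α v ≠ c) :
    ∃ c', ∀ v ∈ H.supp, ∃ x, Transfers e α v c x c' := by
  obtain ⟨r, hr⟩ := H.nonempty_supp
  obtain ⟨x, c', hx⟩ := (available_of_missing hc hr).exists_transfers e
  refine ⟨c', fun v hv => ?_⟩
  obtain ⟨p⟩ := ConnectedComponent.exact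
    (((H.mem_supp_iff v).1 hv).trans ((H.mem_supp_iff r).1 hr).symm)
  clear hr
  induction p with
  | nil => exact ⟨x, hx⟩
  | @cons v w r hvw p ih =>
    obtain ⟨y, hy⟩ := ih hx ((H.mem_supp_congr_adj hvw).1 hv)
    obtain ⟨z, d', hz⟩ := (available_of_missing hc hv).exists_transfers e
    obtain ⟨-, h⟩ := (hz.square_iff hy hvw.ne).1 ⟨hvw, rfl⟩
    exact ⟨z, h ▸ hz⟩

/-- Recoloring a set `S` of vertices of the same color in a component `H` with a color `c` that
`H` misses. The order does not matter, so these recolorings span a cube. Hence in `G'` precisely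
the labels of `S` are recolored, and recolorings at `α` compatible with those of `S` persist. -/
theorem transfers_of_recolor {c' : Fin k'} (hc : ∀ v ∈ H.supp, α v ≠ c)
    (hc' : ∀ v ∈ H.supp, ∃ x, Transfers e α v c x c') (S : Finset V) :
    ∀ β : G.Coloring (Fin k), (∀ v ∈ S, v ∈ H.supp ∧ α v = a ∧ β v = c) →
      (∀ v, v ∉ S → β v = α v) →
      (∀ v ∈ S, ∀ x, HasLabel e α v x → e β x = c') ∧
      (∀ x, (∀ v ∈ S, ¬ HasLabel e α v x) → e β x = e α x) ∧
      ∀ v d x d', v ∉ S → Transfers e α v d x d' → (d ≠ c ∨ ∀ w ∈ S, ¬ G.Adj v w) →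
        Transfers e β v d x d' := by
  classical
  induction S using Finset.induction_on with
  | empty =>
    intro β _ h
    obtain rfl : β = α := by
      ext1 v
      exact h v (Finset.notMem_empty v)
    exact ⟨by simp, fun _ _ => rfl, fun v d x d' _ h _ => h⟩
  | insert t S ht ih =>
    intro β hS hSc
    obtain ⟨htH, hta, htc⟩ := hS t (Finset.mem_insert_self t S)
    have hindep : ∀ w ∈ insert t S, ∀ v ∈ insert t S, ¬ G.Adj v w := fun w hw v hv hvw =>
      α.valid hvw ((hS v hv).2.1.trans (hS w hw).2.1.symm)
    have hav : Available β t a := by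
      refine ⟨?_, fun w hw => ?_⟩
      · rw [htc, ← hta]
        exact hc t htH
      · rw [hSc w fun h => hindep w h t (Finset.mem_insert_self t S) hw, ← hta]
        exact (α.valid hw).symm
    obtain ⟨γ, hγ, hγa⟩ := hav.exists_differAt
    obtain ⟨h1, h2, h3⟩ := ih γ
      (fun v hv => by
        obtain ⟨g1, g2, g3⟩ := hS v (Finset.mem_insert_of_mem hv)
        exact ⟨g1, g2, by rw [← hγ.2 v (fun h => ht (h ▸ hv)), g3]⟩)
      (fun v hv => by
        by_cases hvt : v = t
        · rw [hvt, hγa, hta]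
        · rw [← hγ.2 v hvt, hSc v (by simp [hvt, hv])])
    obtain ⟨x, hx⟩ := hc' t htH
    have hxγ := h3 t c x c' ht hx (Or.inr fun w hw =>
      hindep w (Finset.mem_insert_of_mem hw) t (Finset.mem_insert_self t S))
    obtain ⟨hd, hd'⟩ := hxγ.differAt hγ.symm htc
    refine ⟨fun v hv y hy => ?_, fun y hy => ?_, fun v d y d' hv hvy hh => ?_⟩
    · by_cases hvt : v = t
      · subst hvt
        rwa [hy.unique hx.hasLabel]
      · have hyx : y ≠ x := fun h => hvt (hy.injective (h ▸ hx.hasLabel))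
        rw [← hd.2 y hyx]
        exact h1 v ((Finset.mem_insert.1 hv).resolve_left hvt) y hy
    · have hyx : y ≠ x := fun h => hy t (Finset.mem_insert_self t S) (h ▸ hx.hasLabel)
      rw [← hd.2 y hyx]
      exact h2 y fun v hv => hy v (Finset.mem_insert_of_mem hv)
    · rw [Finset.mem_insert, not_or] at hv
      refine hxγ.move (h3 v d y d' hv.2 hvy ?_) (Ne.symm hv.1) ?_ hγ.symm htc
      · exact hh.imp_right fun g w hw => g w (Finset.mem_insert_of_mem hw)
      · rintro ⟨g1, g2⟩
        rcases hh with hh | hh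
        · exact hh g2.symm
        · exact hh t (Finset.mem_insert_self t S) g1.symm

/-- The effect on `G'` of recoloring the vertices of color `a` in the component `H` with the
color `c`, which leads from `α` to `β`: the labels of these vertices are recolored from `p`
to `q`. -/
structure IsFlip (e : G.coloringGraph k ≃g G'.coloringGraph k') (H : G.ConnectedComponent)
    (a c : Fin k) (α β : G.Coloring (Fin k)) (p q : Fin k') : Prop where
  ne : p ≠ q
  exists_new : ∀ v ∈ H.supp, ∃ x, Transfers e α v c x q
  exists_old : ∀ v ∈ H.supp, ∃ x, Transfers e β v a x p
  moved : ∀ v ∈ H.supp, α v = a → ∀ x, HasLabel e α v x →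
    HasLabel e β v x ∧ e α x = p ∧ e β x = q
  fixed : ∀ x, (∀ v ∈ H.supp, α v = a → ¬ HasLabel e α v x) → e β x = e α x
  other : ∀ v d x d', ¬ (v ∈ H.supp ∧ α v = a) → Transfers e α v d x d' →
    (d ≠ c ∨ ∀ w ∈ H.supp, α w = a → ¬ G.Adj v w) → Transfers e β v d x d'

theorem exists_isFlip [Finite V] (e : G.coloringGraph k ≃g G'.coloringGraph k')
    (hc : ∀ v ∈ H.supp, α v ≠ c) (ha : ∃ v ∈ H.supp, α v = a) :
    ∃ p q, IsFlip e H a c α (swapOn H a c α) p q := by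
  classical
  have := Fintype.ofFinite V
  obtain ⟨r, hrH, hra⟩ := ha
  have hac : a ≠ c := hra ▸ hc r hrH
  set β := swapOn H a c α with hβ
  have hβT : ∀ v ∈ H.supp, α v = a → β v = c := fun v hv h => by
    rw [hβ, swapOn_of_mem hv, h, Equiv.swap_apply_left]
  have hβT' : ∀ v, ¬ (v ∈ H.supp ∧ α v = a) → β v = α v := fun v hv => by
    by_cases hvH : v ∈ H.supp
    · rw [hβ, swapOn_of_mem hvH,
        Equiv.swap_apply_of_ne_of_ne (fun h => hv ⟨hvH, h⟩) (hc v hvH)]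
    · rw [hβ, swapOn_of_notMem hvH]
  have hβa : ∀ v ∈ H.supp, β v ≠ a := fun v hv h => by
    by_cases hva : α v = a
    · exact hac ((hβT v hv hva).symm.trans h).symm
    · exact hva ((hβT' v fun h' => hva h'.2).symm.trans h)
  obtain ⟨q, hq⟩ := exists_transfers_of_missing e hc
  obtain ⟨p, hp⟩ := exists_transfers_of_missing e hβa
  set T : Finset V := {v | v ∈ H.supp ∧ α v = a} with hT
  have hmem : ∀ v, v ∈ T ↔ v ∈ H.supp ∧ α v = a := fun v => by simp [hT]
  obtain ⟨h1, h2, h3⟩ := transfers_of_recolor (a := a) hc hq T β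
    (fun v hv => ⟨((hmem v).1 hv).1, ((hmem v).1 hv).2, hβT v ((hmem v).1 hv).1 ((hmem v).1 hv).2⟩)
    (fun v hv => hβT' v fun h => hv ((hmem v).2 h))
  have hmoved : ∀ v ∈ H.supp, α v = a → ∀ x, HasLabel e α v x →
      HasLabel e β v x ∧ e α x = p ∧ e β x = q := by
    intro v hv hva x hx
    have hav : Available β v a := available_of_missing hβa hv
    -- the last recoloring of the cube, chosen to take place at `v`
    obtain ⟨γ, hγ, hγa⟩ := hav.exists_differAt
    obtain ⟨g1, g2, g3⟩ := transfers_of_recolor (a := a) hc hq (T.erase v) γ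
      (fun w hw => by
        obtain ⟨hwv, hwT⟩ := Finset.mem_erase.1 hw
        rw [hmem] at hwT
        exact ⟨hwT.1, hwT.2, by rw [← hγ.2 w hwv, hβT w hwT.1 hwT.2]⟩)
      (fun w hw => by
        by_cases hwv : w = v
        · rw [hwv, hγa, hva]
        · rw [← hγ.2 w hwv]
          exact hβT' w fun h => hw (Finset.mem_erase.2 ⟨hwv, (hmem w).2 h⟩))
    obtain ⟨y, hy⟩ := hq v hv
    obtain rfl := hx.unique hy.hasLabel
    have hback := (g3 v c x q (Finset.notMem_erase v T) hy (Or.inr fun w hw hvw =>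
      α.valid hvw (hva.trans ((hmem w).1 (Finset.mem_of_mem_erase hw)).2.symm))).back
        hγ.symm (hβT v hv hva)
    rw [hγa, g2 x fun w hw hwx => (Finset.mem_erase.1 hw).1 (hwx.injective hx)] at hback
    obtain ⟨z, hz⟩ := hp v hv
    exact ⟨hback.hasLabel, hback.unique hz, h1 v ((hmem v).2 ⟨hv, hva⟩) x hx⟩
  refine ⟨p, q, ?_, hq, hp, hmoved, fun x hx => h2 x fun v hv => ?_, ?_⟩
  · obtain ⟨x, hx⟩ := hq r hrH
    rw [← (hmoved r hrH hra x hx.hasLabel).2.1]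
    exact hx.available.1.symm
  · exact hx v ((hmem v).1 hv).1 ((hmem v).1 hv).2
  · intro v d x d' hv hvx hh
    exact h3 v d x d' (fun h => hv ((hmem v).1 h)) hvx
      (hh.imp_right fun g w hw => g w ((hmem w).1 hw).1 ((hmem w).1 hw).2)

end Swap

end SimpleGraph

/-! ### Flips preserve the labels of a component -/

namespace SimpleGraph

section Labels

variable {V : Type*} {V' : Type*} {G : SimpleGraph V} {G' : SimpleGraph V'} {k k' : ℕ}
  {H : G.ConnectedComponent} {a b c : Fin k} {α β : G.Coloring (Fin k)} {v w : V} {x : V'}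
  {e : G.coloringGraph k ≃g G'.coloringGraph k'} {p q r s : Fin k'}

theorem IsFlip.free_eq {γ : G.Coloring (Fin k)} {d : Fin k} (h : IsFlip e H a c α β p q)
    (h' : IsFlip e H d a β γ r s) : s = p := by
  obtain ⟨v, hv⟩ := H.nonempty_supp
  obtain ⟨x, hx⟩ := h.exists_old v hv
  obtain ⟨y, hy⟩ := h'.exists_new v hv
  exact hy.unique hx

theorem IsFlip.exists_label (h : IsFlip e H a c α β p q) (hv : v ∈ H.supp) :
    ∃ x, HasLabel e α v x :=
  (h.exists_new v hv).imp fun _ h => h.hasLabel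

theorem IsFlip.exists_label' (h : IsFlip e H a c α β p q) (hv : v ∈ H.supp) :
    ∃ x, HasLabel e β v x :=
  (h.exists_old v hv).imp fun _ h => h.hasLabel

theorem IsFlip.hasLabel_iff (h : IsFlip e H a c α β p q) (hv : v ∈ H.supp) (hva : α v = a) :
    HasLabel e α v x ↔ HasLabel e β v x := by
  refine ⟨fun hx => (h.moved v hv hva x hx).1, fun hx => ?_⟩
  obtain ⟨y, hy⟩ := h.exists_label hv
  rwa [hx.unique (h.moved v hv hva y hy).1]

/-- The vertex `x` keeps its color in a flip, or both colors are known. -/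
theorem IsFlip.apply_eq_or (h : IsFlip e H a c α β p q) (x : V') :
    e β x = e α x ∨ ∃ v ∈ H.supp, α v = a ∧ HasLabel e α v x ∧ e α x = p ∧ e β x = q := by
  by_cases hx : ∀ v ∈ H.supp, α v = a → ¬ HasLabel e α v x
  · exact Or.inl (h.fixed x hx)
  · push Not at hx
    obtain ⟨v, hv, hva, hvx⟩ := hx
    exact Or.inr ⟨v, hv, hva, hvx, (h.moved v hv hva x hvx).2⟩

/-- Vertices adjacent in `G` have adjacent labels, which therefore have different colors. -/
theorem HasLabel.apply_ne {y : V'} (hc : ∀ v ∈ H.supp, α v ≠ c) (hv : v ∈ H.supp)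
    (hvw : G.Adj v w) (hx : HasLabel e α v x) (hy : HasLabel e α w y) : e α x ≠ e α y := by
  obtain ⟨q, hq⟩ := exists_transfers_of_missing e hc
  obtain ⟨x', hx'⟩ := hq v hv
  obtain ⟨y', hy'⟩ := hq w ((H.mem_supp_congr_adj hvw).1 hv)
  rw [hx.unique hx'.hasLabel, hy.unique hy'.hasLabel]
  exact (e α).valid ((hx'.square_iff hy' hvw.ne).1 ⟨hvw, rfl⟩).1

/-- A flip of a color class of `H` preserves the set of labels of `H`. A label of a vertex `v`
could only change if the vertex is adjacent to the flipped class. In this case permute the color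
`a` of the flipped class, the color `b` of `v` and the missing color `c` by six flips, which lead
back to `α`. If the label of `v` at `α` is lost at the next coloring `β`, then its color has to
return in the fourth flip, which determines the colors of that flip in `G'`. But then the label
of `v` at `β` cannot return to its color. -/
theorem exists_hasLabel_swapOn [Finite V] (hc : ∀ v ∈ H.supp, α v ≠ c)
    (ha : ∃ v ∈ H.supp, α v = a) (hv : v ∈ H.supp) (hx : HasLabel e α v x) :
    ∃ w ∈ H.supp, HasLabel e (swapOn H a c α) w x := by
  obtain ⟨p₁, q₁, h₁⟩ := exists_isFlip e hc ha
  by_cases hva : α v = a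
  · exact ⟨v, hv, (h₁.moved v hv hva x hx).1⟩
  by_cases hadj : ∃ t ∈ H.supp, α t = a ∧ G.Adj v t
  swap
  · obtain ⟨y, hy⟩ := h₁.exists_new v hv
    rw [hx.unique hy.hasLabel]
    exact ⟨v, hv, (h₁.other v c y q₁ (fun h => hva h.2) hy
      (Or.inr fun w hw hwa hvw => hadj ⟨w, hw, hwa, hvw⟩)).hasLabel⟩
  obtain ⟨t, ht, hta, hvt⟩ := hadj
  by_contra! hlost
  obtain ⟨b, hb⟩ : ∃ b, α v = b := ⟨_, rfl⟩
  have hba : b ≠ a := hb ▸ hva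
  have hbc : b ≠ c := hb ▸ hc v hv
  have hac : a ≠ c := hta ▸ hc t ht
  have sab : Equiv.swap b a c = c := Equiv.swap_apply_of_ne_of_ne hbc.symm hac.symm
  have sac : Equiv.swap a c b = b := Equiv.swap_apply_of_ne_of_ne hba hbc
  have scb : Equiv.swap c b a = a := Equiv.swap_apply_of_ne_of_ne hac hba.symm
  set β := swapOn H a c α with hβ
  set γ := swapOn H b a β with hγ
  set δ := swapOn H c b γ with hδ
  set ε := swapOn H a c δ with hε
  set ζ := swapOn H b a ε with hζ
  have eβ : ∀ w ∈ H.supp, β w = Equiv.swap a c (α w) := fun w hw => swapOn_of_mem hw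
  have eγ : ∀ w ∈ H.supp, γ w = Equiv.swap b a (β w) := fun w hw => swapOn_of_mem hw
  have eδ : ∀ w ∈ H.supp, δ w = Equiv.swap c b (γ w) := fun w hw => swapOn_of_mem hw
  have eε : ∀ w ∈ H.supp, ε w = Equiv.swap a c (δ w) := fun w hw => swapOn_of_mem hw
  have eζ : ∀ w ∈ H.supp, ζ w = Equiv.swap b a (ε w) := fun w hw => swapOn_of_mem hw
  have hswap : ∀ z : Fin k, Equiv.swap c b (Equiv.swap b a (Equiv.swap a c
      (Equiv.swap c b (Equiv.swap b a (Equiv.swap a c z))))) = z := by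
    intro z
    by_cases h1 : z = a
    · subst h1; simp [sab, sac, scb]
    by_cases h2 : z = b
    · subst h2; simp [sab, sac, scb]
    by_cases h3 : z = c
    · subst h3; simp
    simp [Equiv.swap_apply_of_ne_of_ne, h1, h2, h3]
  have hα : swapOn H c b ζ = α := by
    ext1 w
    by_cases hw : w ∈ H.supp
    · rw [swapOn_of_mem hw, eζ w hw, eε w hw, eδ w hw, eγ w hw, eβ w hw, hswap]
    · rw [swapOn_of_notMem hw, hζ, swapOn_of_notMem hw, hε, swapOn_of_notMem hw, hδ,
        swapOn_of_notMem hw, hγ, swapOn_of_notMem hw, hβ, swapOn_of_notMem hw]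
  have vβ : β v = b := by rw [eβ v hv, hb, sac]
  have vγ : γ v = a := by rw [eγ v hv, vβ, Equiv.swap_apply_left]
  have vδ : δ v = a := by rw [eδ v hv, vγ, scb]
  have vε : ε v = c := by rw [eε v hv, vδ, Equiv.swap_apply_left]
  have vζ : ζ v = c := by rw [eζ v hv, vε, sab]
  have tβ : β t = c := by rw [eβ t ht, hta, Equiv.swap_apply_left]
  have tγ : γ t = c := by rw [eγ t ht, tβ, sab]
  have tδ : δ t = b := by rw [eδ t ht, tγ, Equiv.swap_apply_left]
  have tε : ε t = b := by rw [eε t ht, tδ, sac]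
  -- a flip leaves the old color of the flipped class missing
  have hmiss : ∀ (d f : Fin k) (φ : G.Coloring (Fin k)), (∀ w ∈ H.supp, φ w ≠ f) →
      ∀ w ∈ H.supp, swapOn H d f φ w ≠ d := fun d f φ h w hw hwd =>
    h w hw (by rw [swapOn_of_mem hw, Equiv.swap_apply_eq_iff, Equiv.swap_apply_left] at hwd
               exact hwd)
  have mβ : ∀ w ∈ H.supp, β w ≠ a := hmiss a c α hc
  have mγ : ∀ w ∈ H.supp, γ w ≠ b := hmiss b a β mβ
  have mδ : ∀ w ∈ H.supp, δ w ≠ c := hmiss c b γ mγ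
  have mε : ∀ w ∈ H.supp, ε w ≠ a := hmiss a c δ mδ
  have mζ : ∀ w ∈ H.supp, ζ w ≠ b := hmiss b a ε mε
  obtain ⟨p₂, q₂, h₂⟩ := exists_isFlip e mβ ⟨v, hv, vβ⟩
  obtain ⟨p₃, q₃, h₃⟩ := exists_isFlip e mγ ⟨t, ht, tγ⟩
  obtain ⟨p₄, q₄, h₄⟩ := exists_isFlip e mδ ⟨v, hv, vδ⟩
  obtain ⟨p₅, q₅, h₅⟩ := exists_isFlip e mε ⟨t, ht, tε⟩
  obtain ⟨p₆, q₆, h₆⟩ := exists_isFlip e mζ ⟨v, hv, vζ⟩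
  rw [hα] at h₆
  -- the color free for a flip in `G'` is the one given up in the flip before
  obtain rfl := h₁.free_eq h₂
  obtain rfl := h₂.free_eq h₃
  obtain rfl := h₃.free_eq h₄
  obtain rfl := h₄.free_eq h₅
  obtain rfl := h₅.free_eq h₆
  obtain rfl := h₆.free_eq h₁
  obtain ⟨s, hs⟩ := h₁.exists_label ht
  obtain ⟨hsβ, hsα, hsq⟩ := h₁.moved t ht hta s hs
  have hxζ : HasLabel e ζ v x := (h₆.hasLabel_iff hv vζ).2 hx
  obtain ⟨-, x6, x0⟩ := h₆.moved v hv vζ x hxζ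
  obtain ⟨y, hy⟩ := h₁.exists_label' hv
  obtain ⟨hyγ, y1, y2⟩ := h₂.moved v hv vβ y hy
  -- the colors of the class of `a` and of the class of `v`, at `α` and at `β`
  have hpq := hx.apply_ne hc hv hvt hs
  have hpq' := hy.apply_ne mβ hv hvt hsβ
  rw [x0, hsα] at hpq
  rw [y1, hsq] at hpq'
  have x1 : e β x = e α x := (h₁.apply_eq_or x).resolve_right fun ⟨r, hr, _, hrx, _⟩ => by
    exact hlost r hr (h₁.moved r hr ‹_› x hrx).1
  have x2 : e γ x = e β x := (h₂.apply_eq_or x).resolve_right fun ⟨r, hr, _, hrx, _⟩ =>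
    hlost r hr hrx
  have x5 : e ζ x = e ε x := (h₅.apply_eq_or x).resolve_right fun ⟨r, hr, hrb, hrx, _⟩ => by
    obtain rfl := ((h₅.hasLabel_iff hr hrb).1 hrx).injective hxζ
    exact hbc (hrb.symm.trans vε)
  -- hence the fourth flip recolors `x`
  have x3 : e δ x = e γ x := (h₃.apply_eq_or x).resolve_right fun ⟨r, hr, hrc, hrx, hp, hq⟩ => by
    rcases h₄.apply_eq_or x with h | ⟨r', hr', hra, hrx', -⟩
    · exact hpq' (by rw [← hq, ← h, ← x5, x6])
    · obtain rfl := ((h₃.hasLabel_iff hr hrc).1 hrx).injective hrx'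
      rw [eδ r hr, hrc, Equiv.swap_apply_left] at hra
      exact hba hra
  have x4 : e δ x = q₅ := by
    rcases h₄.apply_eq_or x with h | ⟨-, -, -, -, h, -⟩
    · refine absurd ?_ h₆.ne
      rw [← x6, ← x0, x5, h, x3, x2, x1]
    · exact h
  have e4 : q₅ = q₆ := by rw [← x4, x3, x2, x1, x0]
  -- now `y` cannot change its color after the second flip
  have y3 : e δ y = e γ y := (h₃.apply_eq_or y).resolve_right fun ⟨r, hr, hrc, hry, _⟩ => by
    obtain rfl := hry.injective hyγ
    exact hac (vγ.symm.trans hrc)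
  have y0 : e β y = e α y := (h₁.apply_eq_or y).resolve_right fun ⟨r, hr, hra, hry, _⟩ => by
    obtain rfl := ((h₁.hasLabel_iff hr hra).1 hry).injective hy
    exact hva hra
  have y4 : e ε y = e δ y := (h₄.apply_eq_or y).resolve_right fun ⟨r, hr, hra, hry, h, _⟩ => by
    exact hpq (by rw [← e4, ← h, y3, y2])
  have y5 : e ζ y = e ε y := (h₅.apply_eq_or y).resolve_right fun ⟨r, hr, hra, hry, h, _⟩ => by
    exact hpq (by rw [← h, y4, y3, y2])
  have y6 : e α y = e ζ y := (h₆.apply_eq_or y).resolve_right fun ⟨r, hr, hra, hry, h, _⟩ => by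
    exact h₁.ne (by rw [← h, y5, y4, y3, y2])
  exact h₂.ne (by rw [← y1, y0, y6, y5, y4, y3, y2])

end Labels

end SimpleGraph

/-! ### Copying colorings of `G` to `G'` -/

namespace SimpleGraph

section ColorImage

variable {V : Type*} {V' : Type*} {G : SimpleGraph V} {G' : SimpleGraph V'} {k k' : ℕ}
  {H H₁ H₂ : G.ConnectedComponent} {c c₁ c₂ d d₁ d₂ : Fin k} {α : G.Coloring (Fin k)}
  {v w : V} {x y : V'} {e : G.coloringGraph k ≃g G'.coloringGraph k'} {d' : Fin k'}

/-- On the component `H`, the color `d` of `G` plays the role of the color `d'` of `G'`: either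
`d` is used on `H` and `d'` is the color of a label of a vertex of color `d`, or `d` is missing
on `H` and recoloring a vertex with `d` corresponds to recoloring its label with `d'`. -/
def ColorImage (e : G.coloringGraph k ≃g G'.coloringGraph k') (α : G.Coloring (Fin k))
    (H : G.ConnectedComponent) (d : Fin k) (d' : Fin k') : Prop :=
  (∃ v ∈ H.supp, α v = d ∧ ∃ x, HasLabel e α v x ∧ e α x = d') ∨
    (∀ v ∈ H.supp, α v ≠ d) ∧ ∃ v ∈ H.supp, ∃ x, Transfers e α v d x d'

theorem exists_colorImage (e : G.coloringGraph k ≃g G'.coloringGraph k')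
    (hc : ∀ v ∈ H.supp, α v ≠ c) (d : Fin k) : ∃ d', ColorImage e α H d d' := by
  by_cases hd : ∀ v ∈ H.supp, α v ≠ d
  · obtain ⟨d', h⟩ := exists_transfers_of_missing e hd
    obtain ⟨v, hv⟩ := H.nonempty_supp
    exact ⟨d', Or.inr ⟨hd, v, hv, h v hv⟩⟩
  · push Not at hd
    obtain ⟨v, hv, hvd⟩ := hd
    obtain ⟨x, _, hx⟩ := (available_of_missing hc hv).exists_transfers e
    exact ⟨_, Or.inl ⟨v, hv, hvd, x, hx.hasLabel, rfl⟩⟩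

/-- At most one flip makes the color `d` missing on `H`, and thereby makes its image available
at all labels of `H`. -/
theorem ColorImage.exists_free [Finite V] (h : ColorImage e α H d d')
    (hc : ∀ v ∈ H.supp, α v ≠ c) :
    ∃ β : G.Coloring (Fin k),
      (∀ v ∈ H.supp, ∀ x, HasLabel e α v x → ∃ w ∈ H.supp, Transfers e β w d x d') ∧
      (∀ x, (∀ v ∈ H.supp, α v = d → ¬ HasLabel e α v x) → e β x = e α x) ∧
      (∀ v, v ∉ H.supp → β v = α v) ∧
      ∀ v, v ∉ H.supp → ∀ f x f', Transfers e α v f x f' → Transfers e β v f x f' := by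
  rcases h with ⟨r, hr, hrd, z, hz, rfl⟩ | ⟨hd, r, hr, z, hz⟩
  · obtain ⟨p, q, hf⟩ := exists_isFlip e hc ⟨r, hr, hrd⟩
    obtain ⟨-, rfl, -⟩ := hf.moved r hr hrd z hz
    refine ⟨_, fun v hv x hx => ?_, hf.fixed, fun v hv => swapOn_of_notMem hv,
      fun v hv f x f' hx => hf.other v f x f' (fun h => hv h.1) hx
        (Or.inr fun w hw _ hvw => hv ((H.mem_supp_congr_adj hvw).2 hw))⟩
    obtain ⟨w, hw, hwx⟩ := exists_hasLabel_swapOn hc ⟨r, hr, hrd⟩ hv hx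
    obtain ⟨y, hy⟩ := hf.exists_old w hw
    exact ⟨w, hw, hwx.unique hy.hasLabel ▸ hy⟩
  · obtain ⟨f', hf⟩ := exists_transfers_of_missing e hd
    refine ⟨α, fun v hv x hx => ⟨v, hv, ?_⟩, fun _ _ => rfl, fun _ _ => rfl,
      fun v _ f x f' h => h⟩
    obtain ⟨y, hy⟩ := hf v hv
    obtain ⟨y', hy'⟩ := hf r hr
    rw [hx.unique hy.hasLabel, hz.unique hy']
    exact hy

theorem ColorImage.injective [Finite V] (h₁ : ColorImage e α H d₁ d')
    (h₂ : ColorImage e α H d₂ d') (hc : ∀ v ∈ H.supp, α v ≠ c) : d₁ = d₂ := by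
  by_contra hne
  have key : ∀ {d₁ d₂}, d₁ ≠ d₂ → ColorImage e α H d₁ d' →
      ¬ ∃ v ∈ H.supp, α v = d₂ ∧ ∃ x, HasLabel e α v x ∧ e α x = d' := by
    rintro d₁ d₂ hne h₁ ⟨v, hv, hvd, x, hx, hd'⟩
    obtain ⟨β, g1, g2, -⟩ := h₁.exists_free hc
    obtain ⟨w, hw, hwx⟩ := g1 v hv x hx
    refine hwx.available.1 ?_
    rw [g2 x fun r hr hrd hrx => ?_, hd']
    obtain rfl := hrx.injective hx
    exact hne (hrd.symm.trans hvd)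
  obtain ⟨hm, v, hv, x, hx⟩ := h₁.resolve_left (key (Ne.symm hne) h₂)
  obtain ⟨-, w, hw, y, hy⟩ := h₂.resolve_left (key hne h₁)
  obtain ⟨f', hf⟩ := exists_transfers_of_missing e hm
  obtain ⟨x', hx'⟩ := hf v hv
  obtain ⟨y', hy'⟩ := hf w hw
  rw [← hx.unique hx', ← hy.hasLabel.unique hy'.hasLabel] at hy'
  exact hne (hy'.injective hy)

theorem ColorImage.apply_ne [Finite V] (h : ColorImage e α H d d')
    (hc : ∀ v ∈ H.supp, α v ≠ c) (hv : v ∈ H.supp) (hy : HasLabel e α v y) (hyx : G'.Adj y x)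
    (hx : ∀ v ∈ H.supp, ¬ HasLabel e α v x) : e α x ≠ d' := by
  obtain ⟨β, g1, g2, -⟩ := h.exists_free hc
  obtain ⟨w, hw, hwy⟩ := g1 v hv y hy
  rw [← g2 x fun v hv _ => hx v hv]
  exact hwy.available.2 x hyx

/-- If labels of different components are adjacent in `G'`, then the colors of these components
have different images: otherwise the two components could be brought into a position where the
two labels can be recolored independently of one another with the same color. -/
theorem ColorImage.false_of_adj [Finite V] (h₁ : ColorImage e α H₁ d₁ d')
    (h₂ : ColorImage e α H₂ d₂ d') (hc₁ : ∀ v ∈ H₁.supp, α v ≠ c₁)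
    (hc₂ : ∀ v ∈ H₂.supp, α v ≠ c₂) (hne : H₁ ≠ H₂) (hv : v ∈ H₁.supp) (hw : w ∈ H₂.supp)
    (hx : HasLabel e α v x) (hy : HasLabel e α w y) (hxy : G'.Adj x y) : False := by
  have hdisj : ∀ z, z ∈ H₁.supp → z ∈ H₂.supp → False := fun z h1 h2 => hne (h1.symm.trans h2)
  obtain ⟨β, g1, g2, g3, g4⟩ := h₁.exists_free hc₁
  have hβ : ∀ z ∈ H₂.supp, β z = α z := fun z hz => g3 z fun h => hdisj z h hz
  have h₂' : ColorImage e β H₂ d₂ d' := by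
    rcases h₂ with ⟨r, hr, hrd, z, ⟨f, f', hz⟩, hd⟩ | ⟨hm, r, hr, z, hz⟩
    · refine Or.inl ⟨r, hr, (hβ r hr).trans hrd, z,
        (g4 r (fun h => hdisj r h hr) f z f' hz).hasLabel, ?_⟩
      rw [g2 z fun s hs _ hsz => hdisj s hs (hsz.injective hz.hasLabel ▸ hr), hd]
    · exact Or.inr ⟨fun z hz => hβ z hz ▸ hm z hz, r, hr, z,
        g4 r (fun h => hdisj r h hr) _ z _ hz⟩
  obtain ⟨γ, f1, -, -, f4⟩ := h₂'.exists_free fun z hz => hβ z hz ▸ hc₂ z hz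
  obtain ⟨v', hv', hv'x⟩ := g1 v hv x hx
  obtain ⟨f, f', hy⟩ := hy
  obtain ⟨w', hw', hw'y⟩ := f1 w hw y (g4 w (fun h => hdisj w h hw) f y f' hy).hasLabel
  have hv'x' := f4 v' (fun h => hdisj v' hv' h) _ _ _ hv'x
  have hne' : v' ≠ w' := fun h => hdisj v' hv' (h ▸ hw')
  exact hdisj w' ((H₁.mem_supp_congr_adj ((hv'x'.square_iff hw'y hne').2 ⟨hxy, rfl⟩).1).1 hv') hw'

/-- If the colorings of `G` and `G'` form isomorphic graphs, then at a coloring of `G'` that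
corresponds to a coloring of `G` with a missing color, no vertex of `G'` is frozen. Indeed, the
coloring graph of `G` embeds into the set of colorings of `G'` that are unchanged at all frozen
vertices; and this is a proper subset if there are any. -/
theorem exists_hasLabel [Finite V] [Finite V'] [Nonempty V]
    (e : G.coloringGraph k ≃g G'.coloringGraph k') (hc : ∀ v, α v ≠ c) (x₀ : V') :
    ∃ v, HasLabel e α v x₀ := by
  classical
  by_contra hx₀
  have hav : ∀ v, Available α v c := fun v => ⟨(hc v).symm, fun w _ => hc w⟩
  have hlab : ∀ v, ∃ x, HasLabel e α v x := fun v =>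
    let ⟨x, _, h⟩ := (hav v).exists_transfers e
    ⟨x, h.hasLabel⟩
  choose κ hκ using fun (H : G.ConnectedComponent) =>
    exists_colorImage (H := H) (α := α) e fun v _ => hc v
  have hinj : ∀ H, Function.Injective (κ H) := fun H d₁ d₂ h =>
    (hκ H d₁).injective (h ▸ hκ H d₂) fun v _ => hc v
  let f (γ : G.Coloring (Fin k)) (x : V') : Fin k' :=
    if h : ∃ v, HasLabel e α v x then κ (G.connectedComponentMk h.choose) (γ h.choose) else e α x
  have hf : ∀ γ v x, HasLabel e α v x → f γ x = κ (G.connectedComponentMk v) (γ v) := by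
    intro γ v x hx
    have h : ∃ v, HasLabel e α v x := ⟨v, hx⟩
    have hv : h.choose = v := h.choose_spec.injective hx
    simp only [f]
    rw [dif_pos h, hv]
  have hf' : ∀ γ x, (¬ ∃ v, HasLabel e α v x) → f γ x = e α x := fun γ x h => dif_neg h
  have hproper : ∀ γ x y, G'.Adj x y → f γ x ≠ f γ y := by
    have key : ∀ γ x y, G'.Adj x y → (∃ v, HasLabel e α v x) → f γ x ≠ f γ y := by
      rintro γ x y hxy ⟨v, hx⟩
      rw [hf γ v x hx]
      by_cases hy : ∃ w, HasLabel e α w y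
      · obtain ⟨w, hy⟩ := hy
        rw [hf γ w y hy]
        by_cases hvw : G.connectedComponentMk v = G.connectedComponentMk w
        · rw [← hvw]
          intro h
          obtain ⟨c', hc'⟩ := exists_transfers_of_missing
            (H := G.connectedComponentMk v) e fun v _ => hc v
          obtain ⟨x', hx'⟩ := hc' v rfl
          obtain ⟨y', hy'⟩ := hc' w hvw.symm
          obtain rfl := hx.unique hx'.hasLabel
          obtain rfl := hy.unique hy'.hasLabel
          have hne : v ≠ w := by
            rintro rfl
            exact hxy.ne (hx.unique hy)
          exact γ.valid ((hx'.square_iff hy' hne).2 ⟨hxy, rfl⟩).1 (hinj _ h)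
        · intro h
          exact ColorImage.false_of_adj (hκ (G.connectedComponentMk v) (γ v))
            (h ▸ hκ (G.connectedComponentMk w) (γ w)) (fun v _ => hc v) (fun v _ => hc v) hvw
            rfl rfl hx hy hxy
      · rw [hf' γ y hy]
        exact ((hκ (G.connectedComponentMk v) (γ v)).apply_ne (fun v _ => hc v) rfl hx hxy
          fun w _ hw => hy ⟨w, hw⟩).symm
    intro γ x y hxy
    by_cases hx : ∃ v, HasLabel e α v x
    · exact key γ x y hxy hx
    by_cases hy : ∃ v, HasLabel e α v y
    · exact (key γ y x hxy.symm hy).symm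
    rw [hf' γ x hx, hf' γ y hy]
    exact (e α).valid hxy
  let F (γ : G.Coloring (Fin k)) : G'.Coloring (Fin k') :=
    Coloring.mk (f γ) fun {x y} h => hproper γ x y h
  have hF : Function.Injective F := by
    intro γ γ' h
    ext1 v
    obtain ⟨x, hx⟩ := hlab v
    have h' : f γ x = f γ' x := DFunLike.congr_fun h x
    rw [hf γ v x hx, hf γ' v x hx] at h'
    exact hinj _ h'
  have : Finite (G.Coloring (Fin k)) := DFunLike.finite _
  have hsurj : Function.Surjective (e.symm ∘ F) :=
    Finite.surjective_of_injective (e.symm.injective.comp hF)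
  -- a coloring of `G'` with a different color at `x₀`
  obtain ⟨v⟩ := ‹Nonempty V›
  obtain ⟨x, c', hx⟩ := (hav v).exists_transfers e
  have : Nontrivial (Fin k') := ⟨_, _, hx.available.1⟩
  obtain ⟨d', hd'⟩ := exists_ne (e α x₀)
  let β : G'.Coloring (Fin k') :=
    Coloring.mk (fun x => Equiv.swap (e α x₀) d' (e α x)) fun {x y} h h' =>
      (e α).valid h ((Equiv.swap _ _).injective h')
  obtain ⟨γ, hγ⟩ := hsurj (e.symm β)
  have h' : f γ x₀ = Equiv.swap (e α x₀) d' (e α x₀) :=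
    DFunLike.congr_fun (e.symm.injective hγ) x₀
  rw [hf' γ x₀ hx₀, Equiv.swap_apply_left] at h'
  exact hd' h'.symm

/-- A coloring with the least number of colors has a frozen vertex: otherwise all vertices of
one color could be recolored. -/
theorem chromaticNumber_lt_of_available {α : G.Coloring (Fin k)} [Nonempty V]
    (h : ∀ v, ∃ c, Available α v c) : G.chromaticNumber < k := by
  classical
  obtain ⟨v₀⟩ := ‹Nonempty V›
  choose f hf using h
  let a := α v₀
  let C : G.Coloring {z : Fin k // z ≠ a} := Coloring.mk
    (fun v => if h : α v = a then ⟨f v, h ▸ (hf v).1⟩ else ⟨α v, h⟩) fun {v w} hvw => by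
      split_ifs with h1 h2 h2
      · exact absurd (h1.trans h2.symm) (α.valid hvw)
      · exact fun h => (hf v).2 w hvw (Subtype.ext_iff.1 h).symm
      · exact fun h => (hf w).2 v hvw.symm (Subtype.ext_iff.1 h)
      · exact fun h => α.valid hvw (Subtype.ext_iff.1 h)
  refine lt_of_le_of_lt C.colorable.chromaticNumber_le (Nat.cast_lt.2 ?_)
  rw [Fintype.card_subtype_compl, Fintype.card_fin, Fintype.card_unique]
  exact Nat.sub_lt (Fin.pos a) Nat.one_pos

end ColorImage

end SimpleGraph

/-! ### Cliques and squares in a coloring graph -/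

namespace SimpleGraph

/-- Isomorphic graphs have isomorphic coloring graphs. -/
def Iso.coloringGraph {V V' : Type*} {G : SimpleGraph V} {G' : SimpleGraph V'} (φ : G ≃g G')
    (k : ℕ) : G.coloringGraph k ≃g G'.coloringGraph k where
  toFun α := α.comp φ.symm.toHom
  invFun α := α.comp φ.toHom
  left_inv α := by
    ext1 v
    exact congrArg α (φ.symm_apply_apply v)
  right_inv α := by
    ext1 v
    exact congrArg α (φ.apply_symm_apply v)
  map_rel_iff' {α β} := by
    rw [coloringGraph_adj, coloringGraph_adj]
    constructor
    · rintro ⟨v, h1, h2⟩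
      refine ⟨φ.symm v, h1, fun w hw => ?_⟩
      have := h2 (φ w) (fun h => hw (by rw [← h, φ.symm_apply_apply]))
      change α (φ.symm (φ w)) = β (φ.symm (φ w)) at this
      rwa [φ.symm_apply_apply] at this
    · rintro ⟨v, h1, h2⟩
      refine ⟨φ v, ?_, fun w hw => h2 _ fun h => hw ?_⟩
      · change α (φ.symm (φ v)) ≠ β (φ.symm (φ v))
        rwa [φ.symm_apply_apply]
      · rw [← h]
        exact (φ.apply_symm_apply w).symm

end SimpleGraph

namespace Reconstruction

open SimpleGraph

theorem adj_iff {W : Type*} {C : SimpleGraph W} {V : Type*} {G : SimpleGraph V} {k : ℕ}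
    {x y : W} (e : C ≃g G.coloringGraph k) : C.Adj x y ↔ ∃ v, DifferAt (e x) (e y) v :=
  e.map_adj_iff.symm.trans coloringGraph_adj

theorem cliqueNeighborhood {W : Type*} {C : SimpleGraph W} {V : Type*} {G : SimpleGraph V} {k : ℕ}
    (e : C ≃g G.coloringGraph k) (a : W) : CliqueNeighborhood C a := by
  intro x y z hx hy hz hxy hyz hxz
  obtain ⟨v, hv⟩ := (adj_iff e).1 hx
  obtain ⟨v', hv'⟩ := (adj_iff e).1 hy
  obtain ⟨v'', hv''⟩ := (adj_iff e).1 hz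
  obtain rfl : v = v' := by_contra fun h => hv.not_adj hv' h (e.map_adj_iff.2 hxy)
  obtain rfl : v = v'' := by_contra fun h => hv'.not_adj hv'' h (e.map_adj_iff.2 hyz)
  exact (adj_iff e).2
    ⟨v, (hv.eq_or_differAt hv'').resolve_left fun h => hxz (e.injective h)⟩

variable {W : Type u} [Fintype W] {C : SimpleGraph W} [DecidableRel C.Adj] {V : Type v}
  {G : SimpleGraph V} {k : ℕ}

/-- The neighbors of `a` that correspond to recolorings of the vertex `v`. -/
def cliqueAt (e : C ≃g G.coloringGraph k) (a : W) (v : V) : Finset W :=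
  {y ∈ C.neighborFinset a | e a v ≠ e y v}

variable {e : C ≃g G.coloringGraph k} {a x y z : W} {v w : V}

theorem mem_cliqueAt : x ∈ cliqueAt e a v ↔ DifferAt (e a) (e x) v := by
  rw [cliqueAt, Finset.mem_filter, mem_neighborFinset, adj_iff e]
  constructor
  · rintro ⟨⟨w, hw⟩, hv⟩
    obtain rfl : v = w := by_contra fun h => hv (hw.2 v h)
    exact hw
  · exact fun h => ⟨⟨v, h⟩, h.1⟩

theorem exists_mem_cliqueAt_iff {c : Fin k} :
    (∃ x ∈ cliqueAt e a v, e x v = c) ↔ Available (e a) v c := by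
  constructor
  · rintro ⟨x, hx, rfl⟩
    exact (mem_cliqueAt.1 hx).available
  · intro h
    obtain ⟨β, hβ, hc⟩ := h.exists_differAt
    exact ⟨e.symm β, mem_cliqueAt.2 (by rwa [e.apply_symm_apply]), by rwa [e.apply_symm_apply]⟩

theorem exists_closesSquare_iff (hx : x ∈ cliqueAt e a v) (hy : y ∈ cliqueAt e a w)
    (hvw : v ≠ w) : (∃ z, ClosesSquare C a x y z) ↔ ¬ (G.Adj v w ∧ e x v = e y w) := by
  rw [← (mem_cliqueAt.1 hx).square_iff (mem_cliqueAt.1 hy) hvw]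
  constructor
  · rintro ⟨z, hz, hxz, hyz⟩
    exact ⟨e z, fun h => hz (e.injective h), e.map_adj_iff.2 hxz, e.map_adj_iff.2 hyz⟩
  · rintro ⟨δ, hδ, hxδ, hyδ⟩
    obtain ⟨z, rfl⟩ := e.surjective δ
    exact ⟨z, fun h => hδ (by rw [h]), e.map_adj_iff.1 hxδ, e.map_adj_iff.1 hyδ⟩

theorem ClosesSquare.eq {z' : W} (hx : x ∈ cliqueAt e a v) (hy : y ∈ cliqueAt e a w)
    (hvw : v ≠ w) (hz : ClosesSquare C a x y z) (hz' : ClosesSquare C a x y z') : z = z' := by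
  rw [mem_cliqueAt] at hx hy
  have key : ∀ {z}, ClosesSquare C a x y z → DifferAt (e x) (e z) w ∧ DifferAt (e y) (e z) v :=
    fun h => hx.of_square hy hvw (fun h' => h.1 (e.injective h')) (e.map_adj_iff.2 h.2.1)
      (e.map_adj_iff.2 h.2.2)
  refine e.injective ((key hz).1.eq_of_apply_eq (key hz').1 ?_)
  rw [← (key hz).2.2 w hvw.symm, ← (key hz').2.2 w hvw.symm]

variable [DecidableEq W]

theorem filter_eq_cliqueAt (hx : DifferAt (e a) (e x) v) :
    {y ∈ C.neighborFinset a | y = x ∨ C.Adj x y} = cliqueAt e a v := by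
  ext y
  rw [Finset.mem_filter, mem_neighborFinset, adj_iff e, mem_cliqueAt]
  constructor
  · rintro ⟨⟨w, hw⟩, hy⟩
    by_cases hvw : v = w
    · rwa [hvw]
    · rcases hy with rfl | hy
      · exact absurd (hx.eq_vertex hw) hvw
      · exact absurd (e.map_adj_iff.2 hy) (hx.not_adj hw hvw)
  · intro hy
    refine ⟨⟨v, hy⟩, ?_⟩
    rcases hx.eq_or_differAt hy with h | h
    · exact Or.inl (e.injective h).symm
    · exact Or.inr (e.map_adj_iff.1 h.adj)

theorem mem_cliques {K : Finset W} :
    K ∈ cliques C a ↔ ∃ v, (∃ c, Available (e a) v c) ∧ cliqueAt e a v = K := by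
  rw [cliques, Finset.mem_image]
  constructor
  · rintro ⟨x, hx, rfl⟩
    obtain ⟨v, hv⟩ := (adj_iff e).1 ((C.mem_neighborFinset a x).1 hx)
    exact ⟨v, ⟨_, hv.available⟩, (filter_eq_cliqueAt hv).symm⟩
  · rintro ⟨v, ⟨c, hc⟩, rfl⟩
    obtain ⟨x, hx, -⟩ := exists_mem_cliqueAt_iff.2 hc
    rw [mem_cliqueAt] at hx
    exact ⟨x, (C.mem_neighborFinset a x).2 ((adj_iff e).2 ⟨v, hx⟩), filter_eq_cliqueAt hx⟩

/-- The cliques in the neighborhood of `a` correspond to the vertices of `G` that can be recolored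
in the coloring `e a`. -/
noncomputable def cliqueEquiv (e : C ≃g G.coloringGraph k) (a : W) :
    {v // ∃ c, Available (e a) v c} ≃ Clique C a :=
  Equiv.ofBijective (fun v => ⟨cliqueAt e a v, (mem_cliques (e := e)).2 ⟨v.1, v.2, rfl⟩⟩) <| by
    constructor
    · rintro ⟨v, c, hc⟩ ⟨w, hw⟩ h
      obtain ⟨x, hx, -⟩ := exists_mem_cliqueAt_iff.2 hc
      have h' : cliqueAt e a v = cliqueAt e a w := Subtype.ext_iff.1 h
      exact Subtype.ext ((mem_cliqueAt.1 hx).eq_vertex (mem_cliqueAt.1 (h' ▸ hx)))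
    · rintro ⟨K, hK⟩
      obtain ⟨v, hv, rfl⟩ := (mem_cliques (e := e)).1 hK
      exact ⟨⟨v, hv⟩, rfl⟩

theorem coe_cliqueEquiv (v : {v // ∃ c, Available (e a) v c}) :
    (cliqueEquiv e a v).1 = cliqueAt e a v := rfl

/-- A pair of cliques is deficient precisely if some pair of their vertices lies on no square. -/
theorem card_squares_lt_iff (hvw : v ≠ w) :
    (squares C a (cliqueAt e a v) (cliqueAt e a w)).card <
        (cliqueAt e a v).card * (cliqueAt e a w).card ↔
      ∃ x ∈ cliqueAt e a v, ∃ y ∈ cliqueAt e a w, ¬ ∃ z, ClosesSquare C a x y z := by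
  set K := cliqueAt e a v
  set L := cliqueAt e a w
  let f : W × W × W → W × W := fun s => (s.1, s.2.1)
  have hmem : ∀ s, s ∈ squares C a K L ↔
      s.1 ∈ K ∧ s.2.1 ∈ L ∧ ClosesSquare C a s.1 s.2.1 s.2.2 := by
    simp [squares, and_assoc]
  have hinj : Set.InjOn f (squares C a K L) := by
    rintro ⟨x, y, z⟩ h ⟨x', y', z'⟩ h' heq
    obtain ⟨hx, hy, hz⟩ := (hmem _).1 h
    obtain ⟨h1, h2⟩ := Prod.mk.inj heq
    dsimp only at h1 h2 hx hy hz
    subst h1 h2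
    rw [hz.eq hx hy hvw ((hmem _).1 h').2.2]
  have hsub : (squares C a K L).image f ⊆ K ×ˢ L := by
    intro p hp
    obtain ⟨s, hs, rfl⟩ := Finset.mem_image.1 hp
    exact Finset.mem_product.2 ⟨((hmem s).1 hs).1, ((hmem s).1 hs).2.1⟩
  rw [← Finset.card_image_of_injOn hinj, ← Finset.card_product]
  constructor
  · intro h
    obtain ⟨p, hp, hp'⟩ := Finset.exists_mem_notMem_of_card_lt_card h
    rw [Finset.mem_product] at hp
    exact ⟨p.1, hp.1, p.2, hp.2, fun ⟨z, hz⟩ =>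
      hp' (Finset.mem_image.2 ⟨(p.1, p.2, z), (hmem _).2 ⟨hp.1, hp.2, hz⟩, rfl⟩)⟩
  · rintro ⟨x, hx, y, hy, hz⟩
    refine Finset.card_lt_card (Finset.ssubset_iff_subset_ne.2 ⟨hsub, fun h => ?_⟩)
    have hxy : (x, y) ∈ (squares C a K L).image f := h ▸ Finset.mem_product.2 ⟨hx, hy⟩
    obtain ⟨s, hs, heq⟩ := Finset.mem_image.1 hxy
    obtain ⟨rfl, rfl⟩ := Prod.mk.inj heq
    exact hz ⟨s.2.2, ((hmem s).1 hs).2.2⟩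

theorem matrix_cliqueEquiv (v w : {v // ∃ c, Available (e a) v c}) :
    matrix C a (cliqueEquiv e a v) (cliqueEquiv e a w) = 1 ↔
      G.Adj v w ∧ ∃ c, Available (e a) v c ∧ Available (e a) w c := by
  rw [matrix, ite_eq_left_iff, imp_iff_not (by norm_num), not_not, coe_cliqueEquiv,
    coe_cliqueEquiv, (cliqueEquiv e a).injective.ne_iff]
  constructor
  · rintro ⟨hne, h⟩
    have hne' : v.1 ≠ w.1 := fun h => hne (Subtype.ext h)
    obtain ⟨x, hx, y, hy, h⟩ := (card_squares_lt_iff hne').1 h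
    rw [exists_closesSquare_iff hx hy hne', not_not] at h
    exact ⟨h.1, _, exists_mem_cliqueAt_iff.1 ⟨x, hx, rfl⟩,
      exists_mem_cliqueAt_iff.1 ⟨y, hy, h.2.symm⟩⟩
  · rintro ⟨hvw, c, hv, hw⟩
    refine ⟨fun h => hvw.ne (Subtype.ext_iff.1 h), (card_squares_lt_iff hvw.ne).2 ?_⟩
    obtain ⟨x, hx, hxc⟩ := exists_mem_cliqueAt_iff.2 hv
    obtain ⟨y, hy, hyc⟩ := exists_mem_cliqueAt_iff.2 hw
    refine ⟨x, hx, y, hy, ?_⟩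
    rw [exists_closesSquare_iff hx hy hvw.ne, not_not]
    exact ⟨hvw, hxc.trans hyc.symm⟩

theorem toGraph_matrix_adj (v w : {v // ∃ c, Available (e a) v c}) :
    (toGraph (matrix C a)).Adj (cliqueEquiv e a v) (cliqueEquiv e a w) ↔
      G.Adj v w ∧ ∃ c, Available (e a) v c ∧ Available (e a) w c := by
  rw [toGraph, fromRel_adj, matrix_cliqueEquiv, matrix_cliqueEquiv,
    (cliqueEquiv e a).injective.ne_iff]
  constructor
  · rintro ⟨-, h | ⟨h, c, h1, h2⟩⟩
    · exact h
    · exact ⟨h.symm, c, h2, h1⟩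
  · exact fun h => ⟨fun h' => h.1.ne (Subtype.ext_iff.1 h'), Or.inl h⟩

theorem mem_candidates₁ (e : C ≃g G.coloringGraph k) (a : W) : a ∈ candidates₁ C := by
  rw [candidates₁, Finset.mem_filter]
  exact ⟨Finset.mem_univ a, cliqueNeighborhood e a⟩

theorem card_cliques (e : C ≃g G.coloringGraph k) (a : W) :
    (cliques C a).card = Nat.card {v // ∃ c, Available (e a) v c} := by
  rw [Nat.card_congr (cliqueEquiv e a), Nat.card_eq_fintype_card, Fintype.card_coe]

/-- If some coloring has no frozen vertex, then the second candidates are the colorings without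
frozen vertices. -/
theorem mem_candidates₂ [Finite V] (e : C ≃g G.coloringGraph k) {a₀ : W}
    (h₀ : ∀ v, ∃ c, Available (e a₀) v c) :
    a ∈ candidates₂ C ↔ ∀ v, ∃ c, Available (e a) v c := by
  have hall : ∀ {a}, (∀ v, ∃ c, Available (e a) v c) → (cliques C a).card = Nat.card V :=
    fun {a} h => by rw [card_cliques e, Nat.card_congr (Equiv.subtypeUnivEquiv h)]
  rw [candidates₂, Finset.mem_filter]
  constructor
  · rintro ⟨-, h⟩ v
    have h := h a₀ (mem_candidates₁ e a₀)
    rw [hall h₀, card_cliques e] at h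
    by_contra hv
    exact absurd h (not_le.2 (Finite.card_subtype_lt hv))
  · refine fun h => ⟨mem_candidates₁ e a, fun b _ => ?_⟩
    rw [hall h, card_cliques e]
    exact Finite.card_subtype_le _

/-- The graph of the edges of `G` both of whose ends can be recolored with the same color. -/
def deficientGraph (α : G.Coloring (Fin k)) : SimpleGraph V where
  Adj v w := G.Adj v w ∧ ∃ c, Available α v c ∧ Available α w c
  symm := ⟨fun _ _ ⟨h, c, h1, h2⟩ => ⟨h.symm, c, h2, h1⟩⟩
  loopless := ⟨fun _ h => h.1.ne rfl⟩

/-- The graph read off from `a`, provided that no vertex is frozen in the coloring `e a`. -/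
noncomputable def matrixIso (e : C ≃g G.coloringGraph k) (h : ∀ v, ∃ c, Available (e a) v c) :
    deficientGraph (e a) ≃g toGraph (matrix C a) where
  toEquiv := (Equiv.subtypeUnivEquiv h).symm.trans (cliqueEquiv e a)
  map_rel_iff' := toGraph_matrix_adj _ _

theorem deficientPairs_eq (e : C ≃g G.coloringGraph k) (h : ∀ v, ∃ c, Available (e a) v c) :
    deficientPairs C a = (deficientGraph (e a)).edgeSet.ncard := by
  rw [deficientPairs, edgeFinset_card, ← Nat.card_eq_fintype_card, ← Nat.card_coe_set_eq]
  exact (Nat.card_congr (matrixIso e h).mapEdgeSet).symm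

theorem deficientGraph_le (α : G.Coloring (Fin k)) : deficientGraph α ≤ G := fun _ _ h => h.1

/-- If there is a coloring without frozen vertices such that the ends of every edge can be
recolored with the same color, then the third candidates are the colorings of this kind. -/
theorem mem_candidates₃ [Finite V] (e : C ≃g G.coloringGraph k) {a₀ : W}
    (h₀ : ∀ v, ∃ c, Available (e a₀) v c) (h₀' : deficientGraph (e a₀) = G) :
    a ∈ candidates₃ C ↔ (∀ v, ∃ c, Available (e a) v c) ∧ deficientGraph (e a) = G := by
  rw [candidates₃, Finset.mem_filter, mem_candidates₂ e h₀]
  refine and_congr_right fun h => ?_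
  constructor
  · intro hmax
    have hmax := hmax a₀ ((mem_candidates₂ e h₀).2 h₀)
    rw [deficientPairs_eq e h, deficientPairs_eq e h₀, h₀'] at hmax
    exact edgeSet_injective (Set.eq_of_subset_of_ncard_le
      (edgeSet_mono (deficientGraph_le (e a))) hmax)
  · intro h' b hb
    rw [mem_candidates₂ e h₀] at hb
    rw [deficientPairs_eq e h, deficientPairs_eq e hb, h']
    exact Set.ncard_le_ncard (edgeSet_mono (deficientGraph_le (e b)))

end Reconstruction

/-! ### Selections and the number of colors -/

namespace Reconstruction

open SimpleGraph

variable {W : Type u} [Fintype W] [DecidableEq W] {C : SimpleGraph W} [DecidableRel C.Adj]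
  {V : Type v} {G : SimpleGraph V} {k : ℕ} {e : C ≃g G.coloringGraph k} {a : W}

/-- The number of colors that `α` does not use on the component `H`. -/
noncomputable def missingColors (α : G.Coloring (Fin k)) (H : G.ConnectedComponent) : ℕ :=
  Nat.card {c // ∀ v ∈ H.supp, α v ≠ c}

/-- If no vertex is frozen and all edges are deficient, then the graph read off from `a` is
isomorphic to `G`. -/
noncomputable def graphIso (e : C ≃g G.coloringGraph k) (h : ∀ v, ∃ c, Available (e a) v c)
    (h' : deficientGraph (e a) = G) : G ≃g toGraph (matrix C a) where
  toEquiv := (matrixIso e h).toEquiv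
  map_rel_iff' {v w} := by
    rw [← iff_of_eq (congrArg (fun G' : SimpleGraph V => G'.Adj v w) h')]
    exact (matrixIso e h).map_adj_iff

theorem matrix_graphIso (h : ∀ v, ∃ c, Available (e a) v c) (h' : deficientGraph (e a) = G)
    {v w : V} (hvw : G.Adj v w) :
    matrix C a (graphIso e h h' v) (graphIso e h h' w) = 1 := by
  rw [← h'] at hvw
  exact (matrix_cliqueEquiv ⟨v, h v⟩ ⟨w, h w⟩).2 hvw

/-- In a selection from the cliques of a component, the chosen recolorings of adjacent vertices
use the same color. So the selections correspond to the colors missing on the component. -/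
theorem selections_eq (e : C ≃g G.coloringGraph k) (h : ∀ v, ∃ c, Available (e a) v c)
    (h' : deficientGraph (e a) = G) (H : G.ConnectedComponent) :
    selections C a ((graphIso e h h').connectedComponentEquiv H) = missingColors (e a) H := by
  classical
  set φ := graphIso e h h' with hφ
  set H' := φ.connectedComponentEquiv H with hH'
  have hmemH : ∀ v, φ v ∈ H'.supp ↔ v ∈ H.supp := fun v => by
    rw [ConnectedComponent.mem_supp_iff, ConnectedComponent.mem_supp_iff, hH',
      ← φ.connectedComponentEquiv.injective.eq_iff]
    rfl
  have hpart : ∀ K : Part C a H', ∃ v ∈ H.supp, φ v = K.1 := fun K => by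
    obtain ⟨v, hv⟩ := φ.surjective K.1
    exact ⟨v, (hmemH v).1 (hv ▸ K.2), hv⟩
  choose vert hvert hφvert using hpart
  have hclique : ∀ K : Part C a H', K.1.1 = cliqueAt e a (vert K) := fun K => by
    rw [← hφvert K]
    rfl
  have hex : ∀ c : {c // ∀ v ∈ H.supp, e a v ≠ c}, ∀ K : Part C a H',
      ∃ x ∈ cliqueAt e a (vert K), e x (vert K) = c := fun c K =>
    exists_mem_cliqueAt_iff.2 (available_of_missing c.2 (hvert K))
  choose sel hsel hselc using hex
  have hadj : ∀ K L : Part C a H', matrix C a K.1 L.1 = 1 → G.Adj (vert K) (vert L) := by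
    intro K L hKL
    rw [← hφvert K, ← hφvert L] at hKL
    exact ((matrix_cliqueEquiv ⟨_, h _⟩ ⟨_, h _⟩).1 hKL).1
  have hIsSel : ∀ c, IsSelection C a H' (sel c) := fun c =>
    ⟨fun K => by
      rw [hclique]
      exact hsel c K, fun K L hKL hz => by
      refine (exists_closesSquare_iff (hsel c K) (hsel c L) (hadj K L hKL).ne).1 hz
        ⟨hadj K L hKL, ?_⟩
      rw [hselc, hselc]⟩
  rw [selections, missingColors, ← Fintype.card_subtype, ← Nat.card_eq_fintype_card]
  refine (Nat.card_congr (Equiv.ofBijective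
    (fun c => (⟨sel c, hIsSel c⟩ : {s // IsSelection C a H' s})) ⟨?_, ?_⟩)).symm
  · intro c d hcd
    obtain ⟨v, hv⟩ := H.nonempty_supp
    have : sel c ⟨φ v, (hmemH v).2 hv⟩ = sel d ⟨φ v, (hmemH v).2 hv⟩ :=
      congrFun (Subtype.ext_iff.1 hcd) _
    apply Subtype.ext
    rw [← hselc c ⟨φ v, (hmemH v).2 hv⟩, ← hselc d ⟨φ v, (hmemH v).2 hv⟩, this]
  · rintro ⟨s, hs, hs'⟩
    have hmem : ∀ v (hv : v ∈ H.supp), s ⟨φ v, (hmemH v).2 hv⟩ ∈ cliqueAt e a v := fun v hv =>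
      hs ⟨φ v, (hmemH v).2 hv⟩
    obtain ⟨r, hr⟩ := H.nonempty_supp
    have hconst : ∀ v (hv : v ∈ H.supp),
        e (s ⟨φ v, (hmemH v).2 hv⟩) v = e (s ⟨φ r, (hmemH r).2 hr⟩) r := by
      intro v hv
      obtain ⟨p⟩ := ConnectedComponent.exact
        (((H.mem_supp_iff v).1 hv).trans ((H.mem_supp_iff r).1 hr).symm)
      induction p with
      | nil => rfl
      | @cons v w r hvw p ih =>
        have hw := (H.mem_supp_congr_adj hvw).1 hv
        rw [← ih hr hw]
        have := hs' ⟨φ v, (hmemH v).2 hv⟩ ⟨φ w, (hmemH w).2 hw⟩ (matrix_graphIso h h' hvw)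
        rw [exists_closesSquare_iff (hmem v hv) (hmem w hw) hvw.ne, not_not] at this
        exact this.2
    refine ⟨⟨e (s ⟨φ r, (hmemH r).2 hr⟩) r, fun v hv => ?_⟩, Subtype.ext (funext fun K => ?_)⟩
    · rw [← hconst v hv]
      exact (mem_cliqueAt.1 (hmem v hv)).1
    · have hK := hconst (vert K) (hvert K)
      have hK' : (⟨φ (vert K), (hmemH _).2 (hvert K)⟩ : Part C a H') = K :=
        Subtype.ext (hφvert K)
      rw [hK'] at hK
      have hsK := hs K
      rw [hclique, mem_cliqueAt] at hsK
      exact e.injective ((mem_cliqueAt.1 (hsel _ K)).eq_of_apply_eq hsK ((hselc _ K).trans hK.symm))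

/-- The chromatic number of a component, as a natural number; this is meaningful for finite
components, whose chromatic number is not `⊤`. -/
noncomputable def compChi (H : G.ConnectedComponent) : ℕ :=
  (G.induce H.supp).chromaticNumber.toNat

theorem _root_.SimpleGraph.Iso.chromaticNumber_eq {V V' : Type*} {G : SimpleGraph V}
    {G' : SimpleGraph V'} (φ : G ≃g G') : G.chromaticNumber = G'.chromaticNumber :=
  le_antisymm (chromaticNumber_mono_of_hom φ.toHom) (chromaticNumber_mono_of_hom φ.symm.toHom)

theorem componentChi_eq (e : C ≃g G.coloringGraph k) (h : ∀ v, ∃ c, Available (e a) v c)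
    (h' : deficientGraph (e a) = G) (H : G.ConnectedComponent) :
    componentChi C a ((graphIso e h h').connectedComponentEquiv H) = compChi H := by
  rw [compChi, componentChi, ← ENat.toNat_natCast (chi _), coe_chi]
  congr 1
  exact (Iso.chromaticNumber_eq
    ⟨ConnectedComponent.isoEquivSupp (graphIso e h h') H, (graphIso e h h').map_adj_iff⟩).symm

theorem totalSelections_eq [Fintype G.ConnectedComponent] (e : C ≃g G.coloringGraph k)
    (h : ∀ v, ∃ c, Available (e a) v c) (h' : deficientGraph (e a) = G) :
    totalSelections C a = ∑ H : G.ConnectedComponent, missingColors (e a) H := by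
  rw [totalSelections, ← (graphIso e h h').connectedComponentEquiv.sum_comp]
  exact Finset.sum_congr rfl fun H _ => selections_eq e h h' H

theorem colorNumerator_eq [Fintype G.ConnectedComponent] (e : C ≃g G.coloringGraph k)
    (h : ∀ v, ∃ c, Available (e a) v c) (h' : deficientGraph (e a) = G) :
    colorNumerator C a = ∑ H : G.ConnectedComponent, (missingColors (e a) H + compChi H) := by
  rw [colorNumerator, totalSelections_eq e h h', Finset.sum_add_distrib,
    ← (graphIso e h h').connectedComponentEquiv.sum_comp (componentChi C a)]
  congr 1
  exact Finset.sum_congr rfl fun H _ => componentChi_eq e h h' H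

theorem missingColors_add_card (α : G.Coloring (Fin k)) (H : G.ConnectedComponent) :
    missingColors α H + Nat.card {c // ∃ v ∈ H.supp, α v = c} = k := by
  classical
  have := Fintype.card_subtype_compl fun c => ∃ v ∈ H.supp, α v = c
  simp only [missingColors, Nat.card_eq_fintype_card]
  have h2 := Fintype.card_subtype_le fun c => ∃ v ∈ H.supp, α v = c
  simp only [not_exists, not_and, Fintype.card_fin] at this h2
  simp only [ne_eq, this]
  omega

theorem missingColors_add_compChi_le (α : G.Coloring (Fin k)) (H : G.ConnectedComponent) :
    missingColors α H + compChi H ≤ k := by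
  classical
  conv_rhs => rw [← missingColors_add_card α H]
  refine Nat.add_le_add_left ?_ _
  let D : (G.induce H.supp).Coloring {c // ∃ v ∈ H.supp, α v = c} :=
    Coloring.mk (fun v => ⟨α v, v, v.2, rfl⟩) fun {v w} hvw h =>
      α.valid hvw (Subtype.ext_iff.1 h)
  rw [Nat.card_eq_fintype_card]
  exact ENat.toNat_le_of_le_natCast D.colorable.chromaticNumber_le

/-- Optimal colorings of the components combine to a coloring of `G` that misses a color. -/
theorem exists_optimal_coloring [Finite V] (hk : G.chromaticNumber < k) :
    ∃ α : G.Coloring (Fin k), (∃ c, ∀ v, α v ≠ c) ∧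
      ∀ H : G.ConnectedComponent, missingColors α H + compChi H = k := by
  classical
  obtain ⟨n, hn⟩ := ENat.ne_top_iff_exists.1 hk.ne_top
  rw [← hn, Nat.cast_lt] at hk
  have hχ : ∀ H : G.ConnectedComponent,
      (G.induce H.supp).Colorable (compChi H) ∧ compChi H ≤ n := by
    intro H
    have hle : (G.induce H.supp).chromaticNumber ≤ n :=
      (chromaticNumber_mono_of_hom (Embedding.induce H.supp).toHom).trans hn.ge
    have hne : (G.induce H.supp).chromaticNumber ≠ ⊤ :=
      ne_top_of_le_ne_top (ENat.natCast_ne_top n) hle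
    exact ⟨colorable_of_chromaticNumber_ne_top hne, ENat.toNat_le_of_le_natCast hle⟩
  let D : ∀ H : G.ConnectedComponent, (G.induce H.supp).Coloring (Fin (compChi H)) :=
    fun H => (hχ H).1.some
  have hlt : ∀ H : G.ConnectedComponent, compChi H ≤ k := fun H => (hχ H).2.trans hk.le
  let f : V → Fin k := fun v =>
    Fin.castLE (hlt (G.connectedComponentMk v)) (D (G.connectedComponentMk v) ⟨v, rfl⟩)
  have hf : ∀ (H : G.ConnectedComponent) v (hv : v ∈ H.supp),
      f v = Fin.castLE (hlt H) (D H ⟨v, hv⟩) := by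
    rintro H v rfl
    rfl
  let α : G.Coloring (Fin k) := Coloring.mk f fun {v w} hvw h => by
    rw [hf (G.connectedComponentMk v) v rfl, hf (G.connectedComponentMk v) w
      (ConnectedComponent.connectedComponentMk_eq_of_adj hvw.symm)] at h
    exact (D _).valid (by exact hvw) (Fin.castLE_injective _ h)
  refine ⟨α, ⟨⟨n, hk⟩, fun v h => ?_⟩, fun H => ?_⟩
  · have h1 : (f v).1 = n := congrArg Fin.val h
    have h2 : (f v).1 < compChi (G.connectedComponentMk v) :=
      (D (G.connectedComponentMk v) ⟨v, rfl⟩).2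
    exact absurd (hχ (G.connectedComponentMk v)).2 (not_le.2 (h1 ▸ h2))
  · refine le_antisymm (missingColors_add_compChi_le α H) ?_
    conv_lhs => rw [← missingColors_add_card α H]
    refine Nat.add_le_add_left ?_ _
    have hsub : {c | ∃ v ∈ H.supp, α v = c} ⊆ Set.range (Fin.castLE (hlt H)) := by
      rintro c ⟨v, hv, rfl⟩
      exact ⟨_, (hf H v hv).symm⟩
    calc Nat.card {c // ∃ v ∈ H.supp, α v = c}
        ≤ Nat.card (Set.range (Fin.castLE (hlt H))) := Nat.card_mono (Set.toFinite _) hsub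
      _ ≤ Nat.card (Fin (compChi H)) := Finite.card_range_le _
      _ = compChi H := Nat.card_fin _

theorem deficientGraph_eq_of_missing {α : G.Coloring (Fin k)} {c : Fin k} (hc : ∀ v, α v ≠ c) :
    deficientGraph α = G :=
  le_antisymm (deficientGraph_le α) fun _ _ hvw =>
    ⟨hvw, c, ⟨(hc _).symm, fun w _ => hc w⟩, ⟨(hc _).symm, fun w _ => hc w⟩⟩

/-- The procedure succeeds for every coloring graph with more colors than necessary. -/
theorem reconstruct_spec [Finite V] [Nonempty V] (e : C ≃g G.coloringGraph k)
    (hk : G.chromaticNumber < k) :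
    (finalCandidates C).Nonempty ∧ ∀ a ∈ finalCandidates C,
      reconstruct C a = some (finalCandidates C, matrix C a, k) ∧
        Nonempty (toGraph (matrix C a) ≃g G) := by
  classical
  have := Fintype.ofFinite G.ConnectedComponent
  obtain ⟨α, ⟨c, hc⟩, hα⟩ := exists_optimal_coloring hk
  obtain ⟨a₀, rfl⟩ := e.surjective α
  have h₀ : ∀ v, ∃ c, Available (e a₀) v c := fun v => ⟨c, (hc v).symm, fun w _ => hc w⟩
  have h₀' := deficientGraph_eq_of_missing hc
  have hmem : ∀ {a}, a ∈ candidates₃ C ↔ _ := mem_candidates₃ e h₀ h₀'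
  have ha₀ : a₀ ∈ candidates₃ C := hmem.2 ⟨h₀, h₀'⟩
  constructor
  · obtain ⟨a, ha, hmax⟩ := Finset.exists_max_image (candidates₃ C) (totalSelections C) ⟨a₀, ha₀⟩
    exact ⟨a, Finset.mem_filter.2 ⟨ha, hmax⟩⟩
  intro a ha
  obtain ⟨ha₃, hmax⟩ := Finset.mem_filter.1 ha
  obtain ⟨h, h'⟩ := hmem.1 ha₃
  let φ := graphIso e h h'
  have hcard : Fintype.card (Component C a) = Fintype.card G.ConnectedComponent :=
    (Fintype.card_congr φ.connectedComponentEquiv).symm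
  have hpos : 0 < Fintype.card (Component C a) := by
    rw [hcard, Fintype.card_pos_iff]
    exact ⟨G.connectedComponentMk (Classical.arbitrary V)⟩
  have hnum : colorNumerator C a = Fintype.card (Component C a) * k := by
    have h1 : colorNumerator C a ≤ ∑ _H : G.ConnectedComponent, k := by
      rw [colorNumerator_eq e h h']
      exact Finset.sum_le_sum fun H _ => missingColors_add_compChi_le (e a) H
    have h2 : ∑ _H : G.ConnectedComponent, k ≤ colorNumerator C a := by
      rw [colorNumerator_eq e h h', ← Finset.sum_congr rfl fun H _ => hα H,
        Finset.sum_add_distrib, Finset.sum_add_distrib]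
      refine Nat.add_le_add_right ?_ _
      rw [← totalSelections_eq e h h', ← totalSelections_eq e h₀ h₀']
      exact hmax a₀ ha₀
    rw [le_antisymm h1 h2, hcard, Finset.sum_const, smul_eq_mul, Finset.card_univ]
  have hcolors : colors C a = k := by
    rw [colors, hnum, Nat.mul_div_cancel_left k hpos]
  refine ⟨?_, ⟨φ.symm⟩⟩
  rw [reconstruct, hcolors, if_pos]
  exact ⟨ha, hpos, hnum ▸ dvd_mul_right _ _, ⟨e.trans (φ.coloringGraph k)⟩⟩

end Reconstruction

/-! ### The theorem -/

namespace SimpleGraph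

variable {V : Type*} {V' : Type*} {G : SimpleGraph V} {G' : SimpleGraph V'} {k k' : ℕ}

/-- A graph whose coloring graph is isomorphic to one with more colors than necessary has at
least one vertex and is itself colored with more colors than necessary. -/
theorem chromaticNumber_lt_of_iso [Finite V] [Finite V'] [Nonempty V]
    (hk : G.chromaticNumber < k) (e : G.coloringGraph k ≃g G'.coloringGraph k') :
    Nonempty V' ∧ G'.chromaticNumber < k' := by
  obtain ⟨α, ⟨c, hc⟩, -⟩ := Reconstruction.exists_optimal_coloring hk
  obtain ⟨v⟩ := ‹Nonempty V›
  have hav : Available α v c := ⟨(hc v).symm, fun w _ => hc w⟩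
  obtain ⟨x, -⟩ := hav.exists_transfers e
  have : Nonempty V' := ⟨x⟩
  refine ⟨this, chromaticNumber_lt_of_available (α := e α) fun y => ?_⟩
  obtain ⟨v, _, c', h⟩ := exists_hasLabel e hc y
  exact ⟨c', h.available⟩

end SimpleGraph

theorem theorem1p1 {W : Type u} [Fintype W] [DecidableEq W] {V : Type v} [Finite V] [Nonempty V]
    (C : SimpleGraph W) [DecidableRel C.Adj] (G : SimpleGraph V) (k : ℕ)
    (hk : G.chromaticNumber < (k : ℕ∞)) (hC : Nonempty (C ≃g G.coloringGraph k)) :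
    (∀ (V' : Type w) [Finite V'] (G' : SimpleGraph V') (k' : ℕ),
        Nonempty (C ≃g G'.coloringGraph k') → Nonempty (G ≃g G') ∧ k = k') ∧
    (∀ (V' : Type w) [Finite V'] (G' : SimpleGraph V') (k' : ℕ),
        G'.chromaticNumber < (k' : ℕ∞) →
        Nonempty (G.coloringGraph k ≃g G'.coloringGraph k') → Nonempty (G ≃g G') ∧ k = k') ∧
    (∀ (V' : Type w) [Finite V'] (G' : SimpleGraph V') (χ' : ℕ),
        G'.chromaticNumber = (χ' : ℕ∞) →
        IsEmpty (G.coloringGraph k ≃g G'.coloringGraph χ')) ∧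
    ((Reconstruction.finalCandidates C).Nonempty ∧
      ∀ a ∈ Reconstruction.finalCandidates C,
        ∃ M : Matrix (Reconstruction.Clique C a) (Reconstruction.Clique C a) ℕ,
          Reconstruction.reconstruct C a = some (Reconstruction.finalCandidates C, M, k) ∧
          Nonempty (Reconstruction.toGraph M ≃g G)) := by
  obtain ⟨e⟩ := hC
  obtain ⟨⟨a, ha⟩, hspec⟩ := Reconstruction.reconstruct_spec e hk
  have huniq : ∀ (V' : Type w) [Finite V'] (G' : SimpleGraph V') (k' : ℕ),
      Nonempty (C ≃g G'.coloringGraph k') → Nonempty (G ≃g G') ∧ k = k' := by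
    rintro V' _ G' k' ⟨e'⟩
    obtain ⟨_, hk'⟩ := SimpleGraph.chromaticNumber_lt_of_iso hk (e.symm.trans e')
    -- the procedure reads off both graphs and both numbers from the same candidate
    obtain ⟨h, ⟨φ⟩⟩ := hspec a ha
    obtain ⟨h', ⟨φ'⟩⟩ := (Reconstruction.reconstruct_spec e' hk').2 a ha
    rw [h, Option.some_inj, Prod.mk.injEq, Prod.mk.injEq] at h'
    exact ⟨⟨φ.symm.trans φ'⟩, h'.2.2⟩
  refine ⟨huniq, fun V' _ G' k' _ ⟨f⟩ => huniq V' G' k' ⟨e.trans f⟩, fun V' _ G' χ' hχ' => ⟨fun f =>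
    (SimpleGraph.chromaticNumber_lt_of_iso hk f).2.ne hχ'⟩, ⟨a, ha⟩, fun a ha => ?_⟩
  exact ⟨_, hspec a ha⟩
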